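/- \textbf{Definitions.} For entire $f$ let $f^*(z)=\overline{f(\bar z)}$. An entire function $E$ is Hermite--Biehler ($E\in\mathcal{HB}$) if $|E(\bar z)|<|E(z)|$ whenever $\operatorname{Im} z>0$. The de Branges space $\mathcal H(E)$ consists of the entire $f$ with $\int_{\mathbb R}|f/E|^2\,dt<\infty$ such that $f/E$ and $f^*/E$ are of bounded type and of nonpositive mean type in the upper half-plane; its inner product is $\langle f,g\rangle_E=\int_{\mathbb R} f\bar g\,|E|^{-2}\,dt$, and its reproducing kernel is $$K_E(w,z)=\frac{\overline{E(w)}E(z)-E(\bar w)E^*(z)}{2\pi i(\bar w-z)},$$ extended by continuity to $z=\bar w$. A phase function of $E$ is a continuous strictly increasing $\varphi_E:\mathbb R\to\mathbb R$ with $E(x)=|E(x)|e^{-i\varphi_E(x)}$ for all $x\in\mathbb R$. A sequence $\{x_n\}$ in a Hilbert space is a Parseval frame if $\sum_n|\langle f,x_n\rangle|^2=\|f\|^2$ for all $f$. An isometric embedding $T:\mathcal H\to\mathcal K$ is said to embed a sequence $\{x_n\}\subset\mathcal H$ into a sequence $\{e_n\}\subset\mathcal K$ if $P e_n=Tx_n$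 for all $n$, where $P$ is the orthogonal projection of $\mathcal K$ onto $T(\mathcal H)$. \textbf{Corollary.} Let $E,F\in\mathcal{HB}$ have no real zeros, let $\varphi_{EF}$ be a phase function of $EF$, let $\alpha\in[0,\pi)$, and let $\{\lambda_n\}_{n\in\mathbb Z}\subset\mathbb R$ satisfy $\varphi_{EF}(\lambda_n)=n\pi+\alpha$ for all $n\in\mathbb Z$. Suppose that $\{K_E(\lambda_n,\cdot)\}_{n\in\mathbb Z}$ is a Parseval frame for $\mathcal H(E)$. Put $h_\alpha=e^{i\alpha}EF-e^{-i\alpha}E^*F^*$, and let $\mathcal K(\alpha)=\mathcal H(EF)$ if $h_\alpha\notin\mathcal H(EF)$ and $\mathcal K(\alpha)=\mathcal H(EF)\ominus\operatorname{span}\{h_\alpha\}$ if $h_\alpha\in\mathcal H(EF)$. Then: (1) $\mathcal I f=fF$ and $\mathcal J g=gE^*$ define linear isometries $\mathcal I:\mathcal H(E)\to\mathcal H(EF)$ and $\mathcal J:\mathcal H(F)\to\mathcal H(EF)$, and $\mathcal H(EF)=\mathcal I(\mathcal H(E))\oplus\mathcal J(\mathcal H(F))$ (orthogonal sum). In particular,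 if $h_\alpha\notin\mathcal H(EF)$, then $\mathcal I$ maps $\mathcal H(E)$ into $\mathcal K(\alpha)$. (2) The functions $$e_n=\frac{\overline{F(\lambda_n)}\,\mathcal I(K_E(\lambda_n,\cdot))}{\sqrt{K_{EF}(\lambda_n,\lambda_n)}}\ \oplus\ \frac{E(\lambda_n)\,\mathcal J(K_F(\lambda_n,\cdot))}{\sqrt{K_{EF}(\lambda_n,\lambda_n)}},\qquad n\in\mathbb Z,$$ form an orthonormal basis of $\mathcal K(\alpha)$. (3) There is a linear isometric embedding $T:\mathcal H(E)\to\mathcal K(\alpha)$ that embeds the Parseval frame $\{K_E(\lambda_n,\cdot)\}_n$ into the orthonormal basis $\{e_n\}_n$. -/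

import Mathlib

open scoped ComplexConjugate InnerProductSpace

/-- The open upper half-plane `ℂ⁺`. -/
def upperHalf : Set ℂ := {z | 0 < z.im}

/-- The involution `f ↦ f*`, `f*(z) = conj (f (conj z))`. -/
def starFun (f : ℂ → ℂ) : ℂ → ℂ := fun z => conj (f (conj z))

/-- `f` is of bounded type in the upper half-plane: there it is the quotient `P / Q` of two bounded
analytic functions, with `Q` not identically zero (written as `f Q = P`). -/
def IsBoundedType (f : ℂ → ℂ) : Prop :=
  ∃ P Q : ℂ → ℂ, DifferentiableOn ℂ P upperHalf ∧ DifferentiableOn ℂ Q upperHalf ∧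
    (∃ C : ℝ, ∀ z ∈ upperHalf, ‖P z‖ ≤ C) ∧ (∃ C : ℝ, ∀ z ∈ upperHalf, ‖Q z‖ ≤ C) ∧
    (∃ z ∈ upperHalf, Q z ≠ 0) ∧ ∀ z ∈ upperHalf, f z * Q z = P z

/-- The mean type `limsup_{y → +∞} (log |f (i y)|) / y`, an extended real number
(with `log 0 = -∞`). -/
noncomputable def meanType (f : ℂ → ℂ) : EReal :=
  Filter.limsup (fun y : ℝ => ENNReal.log ‖f (y * Complex.I)‖ₑ / (y : EReal)) Filter.atTop

/-- A function of the Hermite-Biehler class: an entire function `E` with `|E (conj z)| < |E z|`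
on the open upper half-plane. -/
structure HermiteBiehler where
  toFun : ℂ → ℂ
  differentiable' : Differentiable ℂ toFun
  norm_conj_lt' : ∀ z ∈ upperHalf, ‖toFun (conj z)‖ < ‖toFun z‖

instance : CoeFun HermiteBiehler (fun _ => ℂ → ℂ) := ⟨HermiteBiehler.toFun⟩

theorem isOpen_upperHalf : IsOpen upperHalf := isOpen_lt continuous_const Complex.continuous_im

theorem isPreconnected_upperHalf : IsPreconnected upperHalf :=
  (convex_halfSpace_im_gt 0).isPreconnected

theorem I_mem_upperHalf : Complex.I ∈ upperHalf := by simp [upperHalf]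

theorem starFun_starFun (f : ℂ → ℂ) : starFun (starFun f) = f := by
  funext z; simp [starFun]

theorem Differentiable.starFun {f : ℂ → ℂ} (hf : Differentiable ℂ f) :
    Differentiable ℂ (starFun f) := by
  intro z
  have h := (hf (conj z)).conj_conj
  rw [Complex.conj_conj] at h
  exact h

theorem IsBoundedType.add {f g : ℂ → ℂ} (hf : IsBoundedType f) (hg : IsBoundedType g) :
    IsBoundedType (f + g) := by
  obtain ⟨P, Q, hP, hQ, ⟨a, ha⟩, ⟨b, hb⟩, ⟨u, hu, hQu⟩, h⟩ := hf
  obtain ⟨P', Q', hP', hQ', ⟨a', ha'⟩, ⟨b', hb'⟩, ⟨u', hu', hQu'⟩, h'⟩ := hg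
  refine ⟨fun z => P z * Q' z + P' z * Q z, fun z => Q z * Q' z, (hP.mul hQ').add (hP'.mul hQ),
    hQ.mul hQ', ⟨a * b' + a' * b, fun z hz => ?_⟩, ⟨b * b', fun z hz => ?_⟩, ?_, fun z hz => ?_⟩
  · have h1 := ha z hz
    have h2 := hb z hz
    have h3 := ha' z hz
    have h4 := hb' z hz
    refine (norm_add_le _ _).trans (add_le_add ?_ ?_)
    · rw [norm_mul]; exact mul_le_mul h1 h4 (norm_nonneg _) ((norm_nonneg _).trans h1)
    · rw [norm_mul]; exact mul_le_mul h3 h2 (norm_nonneg _) ((norm_nonneg _).trans h3)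
  · rw [norm_mul]
    exact mul_le_mul (hb z hz) (hb' z hz) (norm_nonneg _) ((norm_nonneg _).trans (hb z hz))
  · by_contra hcon
    push Not at hcon
    have hne : ∀ᶠ z in nhds u, Q z ≠ 0 :=
      (hQ.differentiableAt (isOpen_upperHalf.mem_nhds hu)).continuousAt.eventually_ne hQu
    refine hQu' ((hQ'.analyticOnNhd
      isOpen_upperHalf).eqOn_zero_of_preconnected_of_eventuallyEq_zero isPreconnected_upperHalf hu
      ?_ hu')
    filter_upwards [hne, isOpen_upperHalf.mem_nhds hu] with z hz hz'
    exact (mul_eq_zero.1 (hcon z hz')).resolve_left hz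
  · simp only [Pi.add_apply]
    rw [← h z hz, ← h' z hz]; ring

theorem IsBoundedType.const_mul {f : ℂ → ℂ} (hf : IsBoundedType f) (c : ℂ) :
    IsBoundedType (fun z => c * f z) := by
  obtain ⟨P, Q, hP, hQ, ⟨a, ha⟩, hb, hu, h⟩ := hf
  refine ⟨fun z => c * P z, Q, hP.const_mul c, hQ, ⟨‖c‖ * a, fun z hz => ?_⟩, hb, hu,
    fun z hz => ?_⟩
  · rw [norm_mul]; exact mul_le_mul_of_nonneg_left (ha z hz) (norm_nonneg _)
  · simp only [← h z hz]; ring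

theorem isBoundedType_zero : IsBoundedType 0 :=
  ⟨0, 1, differentiableOn_const 0, differentiableOn_const 1, ⟨0, by simp⟩, ⟨1, by simp⟩,
    ⟨Complex.I, I_mem_upperHalf, by simp⟩, by simp⟩

theorem meanType_nonpos_iff (f : ℂ → ℂ) :
    meanType f ≤ 0 ↔ ∀ ε : ℝ, 0 < ε →
      ∀ᶠ y : ℝ in Filter.atTop, ‖f (y * Complex.I)‖ ≤ Real.exp (ε * y) := by
  have key : ∀ ε y : ℝ, 0 < y → (ENNReal.log ‖f (y * Complex.I)‖ₑ / (y : EReal) ≤ (ε : EReal) ↔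
      ‖f (y * Complex.I)‖ ≤ Real.exp (ε * y)) := by
    intro ε y hy
    rw [EReal.div_le_iff_le_mul (by exact_mod_cast hy) (EReal.coe_ne_top _), ← EReal.coe_mul,
      ← EReal.log_exp ((y * ε : ℝ) : EReal), ENNReal.log_le_log_iff, EReal.exp_coe,
      ← ofReal_norm, ENNReal.ofReal_le_ofReal_iff (Real.exp_pos _).le, mul_comm y]
  unfold meanType
  rw [Filter.limsup_le_iff']
  constructor
  · intro h ε hε
    filter_upwards [h (ε : EReal) (by exact_mod_cast hε), Filter.eventually_gt_atTop (0 : ℝ)]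
      with y hy hy0
    exact (key ε y hy0).1 hy
  · intro h b hb
    obtain ⟨ε, hε, hεb⟩ := EReal.lt_iff_exists_real_btwn.1 hb
    filter_upwards [h ε (by exact_mod_cast hε), Filter.eventually_gt_atTop (0 : ℝ)] with y hy hy0
    exact ((key ε y hy0).2 hy).trans hεb.le

theorem meanType_add_nonpos {f g : ℂ → ℂ} (hf : meanType f ≤ 0) (hg : meanType g ≤ 0) :
    meanType (f + g) ≤ 0 := by
  rw [meanType_nonpos_iff] at *
  intro ε hε
  filter_upwards [hf (ε / 2) (by linarith), hg (ε / 2) (by linarith),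
    Filter.eventually_ge_atTop (2 / ε)] with y h1 h2 h3
  have h4 : 1 ≤ ε / 2 * y := by
    rw [div_le_iff₀ hε] at h3; linarith
  have h5 := Real.add_one_le_exp (ε / 2 * y)
  have h6 : Real.exp (ε * y) = Real.exp (ε / 2 * y) * Real.exp (ε / 2 * y) := by
    rw [← Real.exp_add]; ring_nf
  rw [h6, Pi.add_apply]
  have := norm_add_le (f (y * Complex.I)) (g (y * Complex.I))
  nlinarith [Real.exp_pos (ε / 2 * y)]

theorem meanType_nonpos_of_bounded {f : ℂ → ℂ} {C : ℝ}
    (h : ∀ᶠ y : ℝ in Filter.atTop, ‖f (y * Complex.I)‖ ≤ C) : meanType f ≤ 0 := by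
  rw [meanType_nonpos_iff]
  intro ε hε
  filter_upwards [h, Filter.eventually_ge_atTop (C / ε)] with y h1 h2
  have h5 := Real.add_one_le_exp (ε * y)
  rw [div_le_iff₀ hε] at h2
  linarith

theorem meanType_const_mul_nonpos {f : ℂ → ℂ} (hf : meanType f ≤ 0) (c : ℂ) :
    meanType (fun z => c * f z) ≤ 0 := by
  rw [meanType_nonpos_iff] at *
  intro ε hε
  filter_upwards [hf (ε / 2) (by linarith),
    Filter.eventually_ge_atTop (2 * ‖c‖ / ε)] with y h1 h3
  have h4 : ‖c‖ ≤ ε / 2 * y := by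
    rw [div_le_iff₀ hε] at h3; linarith
  have h5 := Real.add_one_le_exp (ε / 2 * y)
  have h6 : Real.exp (ε * y) = Real.exp (ε / 2 * y) * Real.exp (ε / 2 * y) := by
    rw [← Real.exp_add]; ring_nf
  rw [h6, norm_mul]
  exact mul_le_mul (by linarith) h1 (norm_nonneg _) (Real.exp_pos _).le

namespace HermiteBiehler

theorem differentiable (E : HermiteBiehler) : Differentiable ℂ E := E.differentiable'

theorem ne_zero (E : HermiteBiehler) {z : ℂ} (hz : z ∈ upperHalf) : E z ≠ 0 :=
  norm_pos_iff.1 ((norm_nonneg _).trans_lt (E.norm_conj_lt' z hz))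

theorem measurable_div (E : HermiteBiehler) {f : ℂ → ℂ} (hf : Continuous f) :
    Measurable (fun t : ℝ => f t / E t) :=
  (hf.comp Complex.continuous_ofReal).measurable.div
    (E.differentiable.continuous.comp Complex.continuous_ofReal).measurable

/-- The product `E F` of two Hermite-Biehler functions. -/
instance : Mul HermiteBiehler where
  mul E F :=
    { toFun := fun z => E z * F z
      differentiable' := E.differentiable.mul F.differentiable
      norm_conj_lt' := fun z hz => by
        rw [norm_mul, norm_mul]
        exact mul_lt_mul'' (E.norm_conj_lt' z hz) (F.norm_conj_lt' z hz) (norm_nonneg _)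
          (norm_nonneg _) }

theorem mul_apply (E F : HermiteBiehler) (z : ℂ) : (E * F) z = E z * F z := rfl

/-- `φ` is a phase function of `E`: it is continuous and strictly increasing, and
`E x = |E x| exp (-i φ x)` on the real line. -/
def IsPhase (E : HermiteBiehler) (φ : ℝ → ℝ) : Prop :=
  Continuous φ ∧ StrictMono φ ∧ ∀ x : ℝ, E x = ‖E x‖ * Complex.exp (-Complex.I * φ x)

/-- The set of functions of the de Branges space of `E`, as a linear subspace of the space of all
functions: the entire `f` with `∫ |f / E|² < ∞` on the real line, such that `f / E` and `f* / E` are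
of bounded type and of nonpositive mean type in the upper half-plane. -/
def deBrangesSubmodule (E : HermiteBiehler) : Submodule ℂ (ℂ → ℂ) where
  carrier := {f | Differentiable ℂ f ∧ MeasureTheory.MemLp (fun t : ℝ => f t / E t) 2 ∧
    IsBoundedType (fun z => f z / E z) ∧ meanType (fun z => f z / E z) ≤ 0 ∧
    IsBoundedType (fun z => starFun f z / E z) ∧ meanType (fun z => starFun f z / E z) ≤ 0}
  add_mem' := by
    rintro f g ⟨h1, h2, h3, h4, h5, h6⟩ ⟨k1, k2, k3, k4, k5, k6⟩
    have e1 : (fun z => (f + g) z / E z) = (fun z => f z / E z) + fun z => g z / E z := by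
      funext z; simp [add_div]
    have e2 : (fun z => starFun (f + g) z / E z)
        = (fun z => starFun f z / E z) + fun z => starFun g z / E z := by
      funext z; simp [starFun, add_div]
    have e3 : (fun t : ℝ => (f + g) t / E t) = (fun t : ℝ => f t / E t) + fun t : ℝ => g t / E t := by
      funext z; simp [add_div]
    refine ⟨h1.add k1, ?_, ?_, ?_, ?_, ?_⟩
    · rw [e3]; exact h2.add k2
    · rw [e1]; exact h3.add k3
    · rw [e1]; exact meanType_add_nonpos h4 k4
    · rw [e2]; exact h5.add k5
    · rw [e2]; exact meanType_add_nonpos h6 k6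
  zero_mem' := by
    have e1 : (fun z => (0 : ℂ → ℂ) z / E z) = 0 := by funext z; simp
    have e2 : (fun z => starFun (0 : ℂ → ℂ) z / E z) = 0 := by funext z; simp [starFun]
    have h0 : meanType 0 ≤ 0 :=
      meanType_nonpos_of_bounded (C := 0) (Filter.Eventually.of_forall fun y => by simp)
    refine ⟨differentiable_const 0, ?_, ?_, ?_, ?_, ?_⟩
    · simp
    · rw [e1]; exact isBoundedType_zero
    · rw [e1]; exact h0
    · rw [e2]; exact isBoundedType_zero
    · rw [e2]; exact h0
  smul_mem' := by
    rintro c f ⟨h1, h2, h3, h4, h5, h6⟩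
    have e1 : (fun z => (c • f) z / E z) = fun z => c * (f z / E z) := by
      funext z; simp [mul_div_assoc]
    have e2 : (fun z => starFun (c • f) z / E z) = fun z => conj c * (starFun f z / E z) := by
      funext z; simp [starFun, mul_div_assoc]
    have e3 : (fun t : ℝ => (c • f) t / E t) = fun t : ℝ => c * (f t / E t) := by
      funext z; simp [mul_div_assoc]
    refine ⟨h1.const_smul c, ?_, ?_, ?_, ?_, ?_⟩
    · rw [e3]; exact h2.const_mul c
    · rw [e1]; exact h3.const_mul c
    · rw [e1]; exact meanType_const_mul_nonpos h4 c
    · rw [e2]; exact h5.const_mul _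
    · rw [e2]; exact meanType_const_mul_nonpos h6 _

/-- The de Branges space `H(E)`. -/
def Space (E : HermiteBiehler) : Type := E.deBrangesSubmodule

namespace Space

variable {E : HermiteBiehler}

instance : CoeFun E.Space (fun _ => ℂ → ℂ) := ⟨fun f => f.1⟩

noncomputable instance : AddCommGroup E.Space := inferInstanceAs (AddCommGroup E.deBrangesSubmodule)

noncomputable instance : Module ℂ E.Space := inferInstanceAs (Module ℂ E.deBrangesSubmodule)

theorem ext {f g : E.Space} (h : ∀ z, f z = g z) : f = g := Subtype.ext (funext h)

theorem add_apply (f g : E.Space) (z : ℂ) : (f + g) z = f z + g z := rfl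

theorem smul_apply (c : ℂ) (f : E.Space) (z : ℂ) : (c • f) z = c * f z := rfl

theorem zero_apply (z : ℂ) : (0 : E.Space) z = 0 := rfl

theorem integrable_inner (f g : E.Space) :
    MeasureTheory.Integrable (fun t : ℝ => g t * conj (f t) / ((‖E t‖ : ℂ) ^ 2)) := by
  have h := (f.2.2.1.star).integrable_mul g.2.2.1
  refine h.congr (Filter.Eventually.of_forall fun t => ?_)
  simp only [Pi.mul_apply, Pi.star_apply, RCLike.star_def, map_div₀]
  rw [← Complex.mul_conj', mul_comm (g _), div_mul_div_comm, mul_comm (E _)]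

/-- The inner product of `H(E)`. Mathlib's inner products are conjugate linear in the first
variable, so that this `⟪f, g⟫` is the integral of `g conj(f) / |E|²`. -/
noncomputable instance : Inner ℂ E.Space :=
  ⟨fun f g => ∫ t : ℝ, g t * conj (f t) / ((‖E t‖ : ℂ) ^ 2)⟩

theorem inner_eq (f g : E.Space) :
    inner ℂ f g = ∫ t : ℝ, g t * conj (f t) / ((‖E t‖ : ℂ) ^ 2) := rfl

theorem inner_self (f : E.Space) : inner ℂ f f = ((∫ t : ℝ, ‖f t / E t‖ ^ 2 : ℝ) : ℂ) := by
  rw [inner_eq, ← integral_complex_ofReal]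
  congr 1
  funext t
  rw [Complex.mul_conj', norm_div, div_pow]
  push_cast
  rfl

theorem definite (f : E.Space) (h : inner ℂ f f = 0) : f = 0 := by
  rw [inner_self, Complex.ofReal_eq_zero,
    MeasureTheory.integral_eq_zero_iff_of_nonneg (fun t => by positivity)
      ((MeasureTheory.memLp_two_iff_integrable_sq_norm f.2.2.1.1).1 f.2.2.1)] at h
  have hc1 : Continuous fun z => f z := f.2.1.continuous
  have hc2 : Continuous fun z => E z := E.differentiable.continuous
  have h1 : (fun t : ℝ => f t * E t) =ᵐ[MeasureTheory.volume] fun _ => 0 := by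
    filter_upwards [h] with t ht
    simpa using ht
  have h2 : (fun t : ℝ => f t * E t) = fun _ => 0 :=
    (Continuous.ae_eq_iff_eq MeasureTheory.volume (by fun_prop) (by fun_prop)).1 h1
  have hd : Differentiable ℂ (fun z => f z * E z) := f.2.1.mul E.differentiable
  have h3 : Set.EqOn (fun z => f z * E z) 0 Set.univ := by
    refine (hd.differentiableOn.analyticOnNhd
      isOpen_univ).eqOn_zero_of_preconnected_of_frequently_eq_zero isPreconnected_univ
      (Set.mem_univ 0) ?_
    have ht : Filter.Tendsto (fun t : ℝ => (t : ℂ)) (nhdsWithin 0 {0}ᶜ) (nhdsWithin 0 {0}ᶜ) := by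
      refine tendsto_nhdsWithin_iff.2 ⟨?_, ?_⟩
      · have := Complex.continuous_ofReal.tendsto 0
        simp only [Complex.ofReal_zero] at this
        exact this.mono_left nhdsWithin_le_nhds
      · filter_upwards [self_mem_nhdsWithin] with t ht
        simpa using ht
    exact ht.frequently (Filter.Frequently.of_forall fun t => congrFun h2 t)
  have h4 : Set.EqOn (fun z => f z) 0 Set.univ := by
    refine (f.2.1.differentiableOn.analyticOnNhd
      isOpen_univ).eqOn_zero_of_preconnected_of_eventuallyEq_zero isPreconnected_univ
      (Set.mem_univ Complex.I) ?_
    filter_upwards [isOpen_upperHalf.mem_nhds I_mem_upperHalf] with z hz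
    exact (mul_eq_zero.1 (h3 (Set.mem_univ z))).resolve_right (E.ne_zero hz)
  exact ext fun z => h4 (Set.mem_univ z)

noncomputable instance instCore : InnerProductSpace.Core ℂ E.Space where
  conj_inner_symm f g := by
    rw [inner_eq, inner_eq, ← integral_conj]
    congr 1
    funext t
    simp [mul_comm]
  re_inner_nonneg f := by
    rw [inner_self]
    simp only [RCLike.re_to_complex, Complex.ofReal_re]
    exact MeasureTheory.integral_nonneg fun t => by positivity
  add_left f g h := by
    rw [inner_eq, inner_eq, inner_eq, ← MeasureTheory.integral_add (integrable_inner _ _)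
      (integrable_inner _ _)]
    congr 1
    funext t
    simp [add_apply, mul_add, add_div]
  smul_left f g c := by
    rw [inner_eq, inner_eq, ← MeasureTheory.integral_const_mul]
    congr 1
    funext t
    simp only [smul_apply, map_mul]
    ring
  definite := definite

noncomputable instance : NormedAddCommGroup E.Space := instCore.toNormedAddCommGroup

noncomputable instance : InnerProductSpace ℂ E.Space := InnerProductSpace.ofCore instCore.toCore

end Space

/-- The numerator `conj(E w) E(z) - E(conj w) E*(z)` of the reproducing kernel. -/
noncomputable def kernelNum (E : HermiteBiehler) (w z : ℂ) : ℂ :=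
  conj (E w) * E z - E (conj w) * starFun E z

/-- The reproducing kernel `K_E(w, z)` of `H(E)`, extended by continuity to `z = conj w`. -/
noncomputable def kernelFun (E : HermiteBiehler) (w z : ℂ) : ℂ :=
  if z = conj w then -deriv (E.kernelNum w) (conj w) / (2 * Real.pi * Complex.I)
  else E.kernelNum w z / (2 * Real.pi * Complex.I * (conj w - z))

theorem differentiable_kernelNum (E : HermiteBiehler) (w : ℂ) :
    Differentiable ℂ (E.kernelNum w) :=
  (E.differentiable.const_mul _).sub (E.differentiable.starFun.const_mul _)

theorem kernelNum_conj (E : HermiteBiehler) (w : ℂ) : E.kernelNum w (conj w) = 0 := by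
  simp [kernelNum, starFun, mul_comm]

theorem kernelFun_eq_dslope (E : HermiteBiehler) (w : ℂ) :
    E.kernelFun w =
      fun z => -dslope (E.kernelNum w) (conj w) z / (2 * Real.pi * Complex.I) := by
  funext z
  unfold kernelFun
  split_ifs with h
  · rw [h, dslope_same]
  · rw [dslope_of_ne _ h, slope_def_field, kernelNum_conj, sub_zero, ← neg_sub (conj w) z, div_neg,
      neg_neg, div_div, mul_comm (conj w - z)]

theorem differentiable_kernelFun (E : HermiteBiehler) (w : ℂ) :
    Differentiable ℂ (E.kernelFun w) := by
  rw [kernelFun_eq_dslope]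
  have h : Differentiable ℂ (dslope (E.kernelNum w) (conj w)) := by
    rw [← differentiableOn_univ, Complex.differentiableOn_dslope Filter.univ_mem]
    exact (E.differentiable_kernelNum w).differentiableOn
  exact h.neg.div_const _

theorem kernelFun_mul (E : HermiteBiehler) (w z : ℂ) :
    E.kernelFun w z * (2 * Real.pi * Complex.I * (conj w - z)) = E.kernelNum w z := by
  by_cases h : z = conj w
  · simp [h, kernelNum_conj]
  · rw [kernelFun, if_neg h, div_mul_cancel₀]
    have : conj w - z ≠ 0 := sub_ne_zero.2 (Ne.symm h)
    have := Real.pi_ne_zero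
    simp_all

theorem starFun_kernelFun (E : HermiteBiehler) (w : ℂ) :
    starFun (E.kernelFun w) = E.kernelFun (conj w) := by
  refine Continuous.ext_on (dense_compl_singleton w)
    (E.differentiable_kernelFun w).starFun.continuous
    (E.differentiable_kernelFun (conj w)).continuous fun z hz => ?_
  have hz1 : z ≠ w := hz
  have hz2 : conj z ≠ conj w := fun h => hz1 ((starRingEnd ℂ).injective h)
  have hz3 : w - z ≠ 0 := sub_ne_zero.2 hz1.symm
  have hpi : (Real.pi : ℂ) ≠ 0 := by exact_mod_cast Real.pi_ne_zero
  simp only [starFun, kernelFun, Complex.conj_conj, if_neg hz1, if_neg hz2, kernelNum, map_div₀,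
    map_sub, map_mul, Complex.conj_I, Complex.conj_ofReal, Complex.conj_ofNat]
  have hI := Complex.I_ne_zero
  field_simp
  ring

theorem norm_kernelFun_div_le (E : HermiteBiehler) (w z : ℂ) (hz : ‖E (conj z)‖ ≤ ‖E z‖) :
    ‖E.kernelFun w z / E z‖ * ‖conj w - z‖ ≤ ‖E w‖ + ‖E (conj w)‖ := by
  have h1 : ‖E.kernelFun w z‖ * (2 * Real.pi * ‖conj w - z‖)
      ≤ (‖E w‖ + ‖E (conj w)‖) * ‖E z‖ := by
    have h2 := congrArg norm (E.kernelFun_mul w z)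
    rw [norm_mul, norm_mul, norm_mul, norm_mul] at h2
    simp only [Complex.norm_I, Complex.norm_real, Real.norm_eq_abs, abs_of_pos Real.pi_pos,
      RCLike.norm_ofNat, mul_one] at h2
    rw [h2]
    refine (norm_sub_le _ _).trans ?_
    simp only [norm_mul, starFun, RCLike.norm_conj]
    nlinarith [norm_nonneg (E (conj w))]
  have h3 : ‖E.kernelFun w z‖ * ‖conj w - z‖ ≤ (‖E w‖ + ‖E (conj w)‖) * ‖E z‖ := by
    refine le_trans ?_ h1
    have h4 : 0 ≤ ‖conj w - z‖ := norm_nonneg _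
    gcongr
    nlinarith [Real.pi_gt_three]
  rcases (norm_nonneg (E z)).eq_or_lt with h0 | h0
  · rw [norm_div, ← h0]; simp; positivity
  · rw [norm_div, div_mul_eq_mul_div, div_le_iff₀ h0]; exact h3

theorem isBoundedType_kernelFun (E : HermiteBiehler) (w : ℂ) :
    IsBoundedType (fun z => E.kernelFun w z / E z) := by
  have hzI : ∀ z ∈ upperHalf, 1 ≤ ‖z + Complex.I‖ := by
    intro z hz
    have h1 := Complex.abs_im_le_norm (z + Complex.I)
    have h2 : (0 : ℝ) < z.im := hz
    simp only [Complex.add_im, Complex.I_im] at h1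
    rw [abs_of_pos (by linarith)] at h1
    linarith
  have hzI0 : ∀ z ∈ upperHalf, z + Complex.I ≠ 0 := fun z hz h => by
    have := hzI z hz
    rw [h, norm_zero] at this
    linarith
  have hQd : DifferentiableOn ℂ (fun z => (conj w - z) / (z + Complex.I)) upperHalf := fun z hz =>
    DifferentiableAt.differentiableWithinAt (DifferentiableAt.fun_div (by fun_prop) (by fun_prop)
      (hzI0 z hz))
  refine ⟨fun z => E.kernelFun w z / E z * ((conj w - z) / (z + Complex.I)),
    fun z => (conj w - z) / (z + Complex.I), ?_, hQd, ⟨‖E w‖ + ‖E (conj w)‖, fun z hz => ?_⟩,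
    ⟨‖conj w + Complex.I‖ + 1, fun z hz => ?_⟩, ?_, fun z hz => rfl⟩
  · exact ((E.differentiable_kernelFun w).differentiableOn.div E.differentiable.differentiableOn
      fun z hz => E.ne_zero hz).mul hQd
  · rw [norm_mul, norm_div (conj w - z), ← mul_div_assoc]
    exact (div_le_self (by positivity) (hzI z hz)).trans
      (E.norm_kernelFun_div_le w z (E.norm_conj_lt' z hz).le)
  · rw [norm_div, div_le_iff₀ (by linarith [hzI z hz])]
    have h1 : conj w - z = (conj w + Complex.I) - (z + Complex.I) := by ring
    rw [h1]
    refine (norm_sub_le _ _).trans ?_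
    nlinarith [hzI z hz, norm_nonneg (conj w + Complex.I)]
  · by_cases h : conj w = Complex.I
    · refine ⟨2 * Complex.I, by simp [upperHalf], ?_⟩
      refine div_ne_zero ?_ (hzI0 _ (by simp [upperHalf]))
      rw [h]
      intro h'
      have := congrArg Complex.im h'
      norm_num at this
    · exact ⟨Complex.I, I_mem_upperHalf,
        div_ne_zero (sub_ne_zero.2 h) (hzI0 _ I_mem_upperHalf)⟩

theorem meanType_kernelFun (E : HermiteBiehler) (w : ℂ) :
    meanType (fun z => E.kernelFun w z / E z) ≤ 0 := by
  refine meanType_nonpos_of_bounded (C := ‖E w‖ + ‖E (conj w)‖) ?_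
  filter_upwards [Filter.eventually_ge_atTop (‖w‖ + 1)] with y hy
  have hy0 : 0 < y := by linarith [norm_nonneg w]
  have h1 := E.norm_kernelFun_div_le w (y * Complex.I)
    (E.norm_conj_lt' _ (by simpa [upperHalf] using hy0)).le
  have h2 : 1 ≤ ‖conj w - y * Complex.I‖ := by
    have h3 := norm_sub_norm_le (y * Complex.I) (conj w)
    rw [norm_sub_rev] at h3
    simp only [norm_mul, Complex.norm_real, Complex.norm_I, Real.norm_eq_abs, abs_of_pos hy0,
      RCLike.norm_conj, mul_one] at h3
    linarith
  exact (le_mul_of_one_le_right (norm_nonneg _) h2).trans h1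

theorem memLp_kernelFun (E : HermiteBiehler) (w : ℂ) :
    MeasureTheory.MemLp (fun t : ℝ => E.kernelFun w t / E t) 2 := by
  have hcont : Continuous (E.kernelFun w) := (E.differentiable_kernelFun w).continuous
  have hmeas := E.measurable_div hcont
  set C := ‖E w‖ + ‖E (conj w)‖ with hC
  have hC0 : 0 ≤ C := by positivity
  have hb : ∀ t : ℝ, ‖E.kernelFun w t / E t‖ * ‖conj w - t‖ ≤ C := fun t =>
    E.norm_kernelFun_div_le w t (by simp)
  obtain ⟨M, hM⟩ : ∃ M : ℝ, ∀ t : ℝ, ‖E.kernelFun w t / E t‖ ≤ M := by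
    have hdiv : ∀ δ : ℝ, 0 < δ → ∀ t : ℝ, δ ≤ ‖conj w - t‖ →
        ‖E.kernelFun w t / E t‖ ≤ C / δ := by
      intro δ hδ t ht
      rw [le_div_iff₀ hδ]
      exact (mul_le_mul_of_nonneg_left ht (norm_nonneg _)).trans (hb t)
    by_cases hw : w.im = 0
    · obtain ⟨x, rfl⟩ : ∃ x : ℝ, w = x := ⟨w.re, Complex.ext (by simp) (by simp [hw])⟩
      by_cases hE : E x = 0
      · refine ⟨0, fun t => ?_⟩
        have hCz : C = 0 := by simp [hC, hE]
        by_cases ht : t = x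
        · rw [ht, hE]; simp
        · have h1 := hb t
          rw [hCz] at h1
          have h2 : 0 < ‖conj (x : ℂ) - t‖ := by
            rw [norm_pos_iff, Complex.conj_ofReal, sub_ne_zero]
            exact_mod_cast Ne.symm ht
          nlinarith [norm_nonneg (E.kernelFun x t / E t)]
      · have hca : ContinuousAt (fun t : ℝ => ‖E.kernelFun x t / E t‖) x := by
          refine ContinuousAt.norm (ContinuousAt.div ?_ ?_ hE)
          · exact (hcont.comp Complex.continuous_ofReal).continuousAt
          · exact (E.differentiable.continuous.comp Complex.continuous_ofReal).continuousAt
        obtain ⟨δ, hδ, hδ'⟩ := Metric.eventually_nhds_iff.1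
          (hca.eventually_lt_const (lt_add_one _))
        refine ⟨max (C / δ) (‖E.kernelFun x x / E x‖ + 1), fun t => ?_⟩
        by_cases ht : dist t x < δ
        · exact (hδ' ht).le.trans (le_max_right _ _)
        · refine (hdiv δ hδ t ?_).trans (le_max_left _ _)
          rw [Complex.conj_ofReal, ← Complex.ofReal_sub, Complex.norm_real, ← dist_eq_norm,
            dist_comm]
          exact not_lt.1 ht
    · refine ⟨C / |w.im|, fun t => hdiv _ (abs_pos.2 hw) t ?_⟩
      have := Complex.abs_im_le_norm (conj w - t)
      simpa using this
  have hM0 : 0 ≤ M := (norm_nonneg _).trans (hM 0)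
  rw [MeasureTheory.memLp_two_iff_integrable_sq_norm hmeas.aestronglyMeasurable]
  refine (integrable_inv_one_add_sq.const_mul (M ^ 2 + (C + ‖w‖ * M) ^ 2)).mono'
    (hmeas.norm.pow_const 2).aestronglyMeasurable (Filter.Eventually.of_forall fun t => ?_)
  set g := ‖E.kernelFun w t / E t‖
  have hg : 0 ≤ g := norm_nonneg _
  have h1 : g * |t| ≤ C + ‖w‖ * M := by
    have h2 : |t| ≤ ‖conj w - t‖ + ‖w‖ := by
      have := norm_sub_norm_le (t : ℂ) (conj w)
      rw [norm_sub_rev, Complex.norm_real, Real.norm_eq_abs, RCLike.norm_conj] at this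
      linarith
    have h3 := hb t
    have h4 := hM t
    calc g * |t| ≤ g * (‖conj w - t‖ + ‖w‖) := mul_le_mul_of_nonneg_left h2 hg
      _ = g * ‖conj w - t‖ + ‖w‖ * g := by ring
      _ ≤ C + ‖w‖ * M := add_le_add h3 (mul_le_mul_of_nonneg_left h4 (norm_nonneg _))
  rw [Real.norm_eq_abs, abs_of_nonneg (by positivity), ← div_eq_mul_inv,
    le_div_iff₀ (by positivity), mul_add, mul_one]
  refine add_le_add (pow_le_pow_left₀ hg (hM t) 2) ?_
  rw [← sq_abs t, ← mul_pow]
  exact pow_le_pow_left₀ (by positivity) h1 2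

/-- The kernel function `K_E(w, ·)` as an element of `H(E)`. -/
noncomputable def kernel (E : HermiteBiehler) (w : ℂ) : E.Space :=
  ⟨E.kernelFun w, E.differentiable_kernelFun w, E.memLp_kernelFun w, E.isBoundedType_kernelFun w,
    E.meanType_kernelFun w, by rw [starFun_kernelFun]; exact E.isBoundedType_kernelFun _,
    by rw [starFun_kernelFun]; exact E.meanType_kernelFun _⟩

/-- The entire function `e^{iα} E - e^{-iα} E*`. -/
noncomputable def angleFun (E : HermiteBiehler) (α : ℝ) : ℂ → ℂ := fun z =>
  Complex.exp (Complex.I * α) * E z - Complex.exp (-Complex.I * α) * starFun E z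

open Classical in
/-- The subspace of `H(E)` that is `H(E) ⊖ span {h}` if `h = e^{iα} E - e^{-iα} E*` belongs to
`H(E)`, and all of `H(E)` if it does not. -/
noncomputable def angleSpace (E : HermiteBiehler) (α : ℝ) : Submodule ℂ E.Space :=
  if h : E.angleFun α ∈ E.deBrangesSubmodule then (Submodule.span ℂ {(⟨_, h⟩ : E.Space)})ᗮ else ⊤

end HermiteBiehler

/-- A Parseval frame: `∑ₙ |⟪f, xₙ⟫|² = ‖f‖²` for every `f`. -/
def IsParsevalFrame {ι H : Type*} [NormedAddCommGroup H] [InnerProductSpace ℂ H] (x : ι → H) :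
    Prop :=
  ∀ f : H, HasSum (fun n => ‖⟪f, x n⟫_ℂ‖ ^ 2) (‖f‖ ^ 2)

/-- The isometric embedding `T : H → K` embeds the sequence `x` of `H` into the sequence `e` of `K`:
the orthogonal projection of `e n` to the range of `T` is `T (x n)`. In other words `x`, carried
over to `T(H)`, is the orthogonal compression of `e`, and `e` is an orthogonal dilation of it. -/
def EmbedsInto {ι H K : Type*} [NormedAddCommGroup H] [InnerProductSpace ℂ H]
    [NormedAddCommGroup K] [InnerProductSpace ℂ K] (T : H →ₗᵢ[ℂ] K) (x : ι → H) (e : ι → K) :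
    Prop :=
  ∀ n, e n - T (x n) ∈ (LinearMap.range T.toLinearMap)ᗮ

/-!
A function analytic in the upper half-plane, of bounded type and nonpositive mean type, obeys the
Phragmén–Lindelöf principle. Dividing `(f / E) ^ 2` by the Herglotz transform of its boundary
density, it follows that `|f / E| ^ 2` is dominated by the Poisson integral of its boundary values.
This bound moves contours to infinity, so that Cauchy's formula shows that `K_E(w, ·)` reproduces
values off the real line; being stable under limits, it also makes `H(E)` complete, and the Riesz
representation theorem then extends the reproducing property to real points.

The identity `K_{EF}(w, z) = conj (F w) K_E(w, z) F z + E (conj w) K_F(w, z) E* z` carries the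
decomposition of `H(EF)`: tested against `J g` at a real point `t`, it shows that `J g` is
orthogonal to `I K_E(t, ·)`, and the adjoint of `I` thus sends `J g` to a function that vanishes on
the real line.

The functions `K_{EF}(λ_n, ·)` are multiples of `h_α z / (z - λ_n)`, hence mutually orthogonal. A
member of `H(EF)` that vanishes at all `λ_n` is `q h_α` with `q` entire, and `q` is constant by
Liouville's theorem, because the real part of `(e^{iα} EF + e^{-iα} E* F*) / h_α` is a positive
multiple of `‖K_{EF}(z, ·)‖ ^ 2 Im z / |h_α z| ^ 2` and positive real part limits growth. So the
only such functions are the multiples of `h_α`, which `K(α)` excludes. Finally, the analysis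
operator of a Parseval frame, read in the coordinates of any orthonormal basis, is the embedding
sought.
-/

section

open Filter Topology MeasureTheory

/-! ### Growth of functions of bounded type -/

theorem norm_le_of_frontier_eventually_le {U : Set ℂ} (hU : IsOpen U)
    (hb : Bornology.IsBounded U) {f : ℂ → ℂ} (hf : DifferentiableOn ℂ f U) {B : ℝ}
    (h : ∀ ζ ∈ frontier U, ∀ c > B, ∀ᶠ z in 𝓝[U] ζ, ‖f z‖ ≤ c) {z : ℂ} (hz : z ∈ U) :
    ‖f z‖ ≤ B := by
  by_contra! hlt
  obtain ⟨b, hBb, hbz⟩ := exists_between hlt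
  obtain ⟨c, hbc, hcz⟩ := exists_between hbz
  set V : Set ℂ := U ∩ {x | c < ‖f x‖}
  have hcont : ContinuousOn (fun x => ‖f x‖) U := hf.continuousOn.norm
  have hVo : IsOpen V := hcont.isOpen_inter_preimage hU isOpen_Ioi
  have hVU : closure V ⊆ U := fun ζ hζ => by
    by_contra hζU
    have hfr : ζ ∈ frontier U := by
      rw [frontier, hU.interior_eq]
      exact ⟨closure_mono Set.inter_subset_left hζ, hζU⟩
    have hev : ∀ᶠ x in 𝓝[V] ζ, ‖f x‖ ≤ b :=
      (h ζ hfr b hBb).filter_mono (nhdsWithin_mono ζ Set.inter_subset_left)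
    have := mem_closure_iff_nhdsWithin_neBot.1 hζ
    obtain ⟨x, hxb, hxV⟩ := (hev.and self_mem_nhdsWithin).exists
    exact absurd hxV.2 (not_lt.2 (hxb.trans hbc.le))
  have hfrV : ∀ x ∈ frontier V, ‖f x‖ ≤ c := fun x hx => by
    by_contra! hcx
    rw [frontier, hVo.interior_eq] at hx
    exact hx.2 ⟨hVU hx.1, hcx⟩
  have hd : DiffContOnCl ℂ f V :=
    ⟨hf.mono Set.inter_subset_left, hf.continuousOn.mono hVU⟩
  exact absurd (Complex.norm_le_of_forall_mem_frontier_norm_le (hb.subset Set.inter_subset_left)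
    hd hfrV (subset_closure ⟨hz, hcz⟩)) (not_le.2 hcz)

theorem norm_le_of_re_nonneg_ball {S : ℂ → ℂ} (hS : DifferentiableOn ℂ S (Metric.ball 0 1))
    (hre : ∀ z ∈ Metric.ball (0 : ℂ) 1, 0 ≤ (S z).re) {z : ℂ} (hz : ‖z‖ < 1) :
    ‖S z‖ ≤ ‖S 0‖ * ((1 + ‖z‖) / (1 - ‖z‖)) := by
  refine le_of_forall_pos_le_add fun ε hε => ?_
  have hM : 0 < ε * (1 - ‖z‖) / 2 := by have : 0 < 1 - ‖z‖ := by linarith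
                                        positivity
  have key := Complex.borelCaratheodory hM hS.neg
    (fun x hx => by simpa using (neg_nonpos.2 (hre x hx)).trans hM.le) one_pos (by simpa using hz)
  have hlast : 2 * (ε * (1 - ‖z‖) / 2) * ‖z‖ / (1 - ‖z‖) ≤ ε := by
    have : 1 - ‖z‖ ≠ 0 := by linarith
    field_simp
    linarith
  simp only [Pi.neg_apply, norm_neg] at key
  rw [mul_div_assoc ‖S 0‖] at key
  linarith

theorem exists_eq_add_conj_of_mem_span_fourier {T : ℝ} {g : C(AddCircle T, ℂ)}
    (hg : g ∈ Submodule.span ℂ (Set.range (fourier (T := T)))) :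
    ∃ p q : ℂ → ℂ, Differentiable ℂ p ∧ Differentiable ℂ q ∧
      ∀ x, g x = p (AddCircle.toCircle x) + conj (q (AddCircle.toCircle x)) := by
  induction hg using Submodule.span_induction with
  | mem g hg =>
    obtain ⟨n, rfl⟩ := hg
    obtain ⟨n, rfl | rfl⟩ := n.eq_nat_or_neg
    · refine ⟨fun z => z ^ n, 0, by fun_prop, differentiable_const 0, fun x => ?_⟩
      simp [AddCircle.toCircle_nsmul]
    · refine ⟨0, fun z => z ^ n, differentiable_const 0, by fun_prop, fun x => ?_⟩
      simp [AddCircle.toCircle_nsmul, AddCircle.toCircle_neg, ← Circle.coe_inv_eq_conj]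
  | zero => exact ⟨0, 0, differentiable_const 0, differentiable_const 0, fun x => by simp⟩
  | add g₁ g₂ _ _ h₁ h₂ =>
    obtain ⟨p₁, q₁, hp₁, hq₁, h₁⟩ := h₁
    obtain ⟨p₂, q₂, hp₂, hq₂, h₂⟩ := h₂
    refine ⟨p₁ + p₂, q₁ + q₂, hp₁.add hp₂, hq₁.add hq₂, fun x => ?_⟩
    simp only [ContinuousMap.add_apply, h₁, h₂, Pi.add_apply, map_add]
    ring
  | smul c g _ h =>
    obtain ⟨p, q, hp, hq, h⟩ := h
    refine ⟨c • p, conj c • q, hp.const_smul c, hq.const_smul _, fun x => ?_⟩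
    simp only [ContinuousMap.smul_apply, h, Pi.smul_apply, smul_eq_mul, map_mul, Complex.conj_conj]
    ring

theorem exists_differentiable_abs_re_sub_lt {h : ℂ → ℝ}
    (hh : ContinuousOn h (Metric.sphere 0 1)) {δ : ℝ} (hδ : 0 < δ) :
    ∃ p : ℂ → ℂ, Differentiable ℂ p ∧ ∀ z ∈ Metric.sphere (0 : ℂ) 1, |(p z).re - h z| < δ := by
  let H : C(UnitAddCircle, ℂ) := ⟨fun x => h (AddCircle.toCircle x), by
    refine Complex.continuous_ofReal.comp (hh.comp_continuous ?_ fun x => ?_)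
    · exact continuous_subtype_val.comp AddCircle.continuous_toCircle
    · exact mem_sphere_zero_iff_norm.2 (Circle.norm_coe _)⟩
  have hH : H ∈ closure (Submodule.span ℂ (Set.range (fourier (T := 1))) : Set _) := by
    rw [← Submodule.topologicalClosure_coe, span_fourier_closure_eq_top]
    exact Set.mem_univ H
  obtain ⟨g, hg, hgH⟩ := Metric.mem_closure_iff.1 hH δ hδ
  obtain ⟨p, q, hp, hq, hpq⟩ := exists_eq_add_conj_of_mem_span_fourier hg
  refine ⟨p + q, hp.add hq, fun z hz => ?_⟩
  obtain ⟨x, hx⟩ := (AddCircle.homeomorphCircle one_ne_zero).surjective ⟨z, hz⟩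
  rw [AddCircle.homeomorphCircle_apply] at hx
  have hgx : (g x).re = ((p + q) z).re := by simp [hpq, hx]
  have hHx : (H x).re = h z := by simp [H, hx]
  rw [← hgx, ← hHx, ← Complex.sub_re]
  refine (Complex.abs_re_le_norm _).trans_lt ?_
  rw [← dist_eq_norm, dist_comm]
  exact (ContinuousMap.dist_apply_le_dist x).trans_lt hgH

theorem norm_le_of_sphere_norm_le {f : ℂ → ℂ} (hf : DiffContOnCl ℂ f (Metric.ball 0 1)) {C : ℝ}
    (h : ∀ z ∈ Metric.sphere (0 : ℂ) 1, ‖f z‖ ≤ C) {z : ℂ} (hz : z ∈ Metric.ball 0 1) :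
    ‖f z‖ ≤ C :=
  Complex.norm_le_of_forall_mem_frontier_norm_le Metric.isBounded_ball hf
    (by rwa [frontier_ball _ one_ne_zero]) (subset_closure hz)

theorem exists_exp_majorant {u : ℂ → ℂ} (hu : DiffContOnCl ℂ u (Metric.ball 0 1)) {δ : ℝ}
    (hδ : 0 < δ) :
    ∃ p : ℂ → ℂ, Differentiable ℂ p ∧ (p 0).im = 0 ∧
      (∀ z ∈ Metric.ball (0 : ℂ) 1, 0 ≤ (p z).re ∧ ‖u z‖ ≤ Real.exp (p z).re) ∧
      ∀ z ∈ Metric.sphere (0 : ℂ) 1, Real.exp (p z).re ≤ Real.exp δ * max ‖u z‖ 1 := by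
  have hpos : ∀ z, 0 < max ‖u z‖ 1 := fun z => one_pos.trans_le (le_max_right _ _)
  have hlog : ContinuousOn (fun z => Real.log (max ‖u z‖ 1) + δ / 2) (Metric.sphere 0 1) := by
    refine (ContinuousOn.log ?_ fun z _ => (hpos z).ne').add continuousOn_const
    exact (hu.continuousOn_ball.mono Metric.sphere_subset_closedBall).norm.sup continuousOn_const
  obtain ⟨p, hp, hpδ⟩ := exists_differentiable_abs_re_sub_lt hlog (half_pos hδ)
  set q : ℂ → ℂ := fun z => p z - (p 0).im * Complex.I
  have hq : Differentiable ℂ q := hp.sub_const _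
  have hqre : ∀ z, (q z).re = (p z).re := fun z => by simp [q]
  have hle : ∀ z ∈ Metric.sphere (0 : ℂ) 1, max ‖u z‖ 1 ≤ Real.exp (q z).re := fun z hz => by
    rw [← Real.log_le_iff_le_exp (hpos z), hqre]
    linarith [(abs_lt.1 (hpδ z hz)).1]
  have hexp : Differentiable ℂ fun z => Complex.exp (-q z) := by fun_prop
  have hnorm : ∀ z, ‖Complex.exp (-q z)‖ = (Real.exp (q z).re)⁻¹ := fun z => by
    rw [Complex.norm_exp, Complex.neg_re, Real.exp_neg]
  refine ⟨q, hq, by simp [q], fun z hz => ⟨?_, ?_⟩, fun z hz => ?_⟩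
  · have h1 := norm_le_of_sphere_norm_le (C := 1) hexp.diffContOnCl (fun x hx => by
      rw [hnorm]
      exact inv_le_one_of_one_le₀ ((le_max_right _ _).trans (hle x hx))) hz
    rw [Complex.norm_exp, Real.exp_le_one_iff, Complex.neg_re] at h1
    linarith
  · have h1 := norm_le_of_sphere_norm_le (C := 1) (hu.smul hexp.diffContOnCl) (fun x hx => by
      rw [norm_smul, hnorm, ← div_eq_mul_inv, div_le_one (Real.exp_pos _)]
      exact (le_max_left _ _).trans (hle x hx)) hz
    rwa [norm_smul, hnorm, ← div_eq_mul_inv, div_le_one (Real.exp_pos _)] at h1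
  · rw [← Real.exp_log (hpos z), ← Real.exp_add, Real.exp_le_exp, hqre]
    linarith [(abs_lt.1 (hpδ z hz)).2]

theorem norm_le_exp_of_norm_mul_le_one_of_diffContOnCl {u Q : ℂ → ℂ}
    (hu : DiffContOnCl ℂ u (Metric.ball 0 1)) (hQ : DiffContOnCl ℂ Q (Metric.ball 0 1))
    (hQ1 : ∀ z ∈ Metric.sphere (0 : ℂ) 1, ‖Q z‖ ≤ 1)
    (huQ : ∀ z ∈ Metric.sphere (0 : ℂ) 1, ‖u z * Q z‖ ≤ 1) (hQ0 : Q 0 ≠ 0)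
    {z : ℂ} (hz : ‖z‖ < 1) :
    ‖u z‖ ≤ Real.exp (-Real.log ‖Q 0‖ * ((1 + ‖z‖) / (1 - ‖z‖))) := by
  have : 0 < 1 - ‖z‖ := by linarith
  set k : ℝ := (1 + ‖z‖) / (1 - ‖z‖)
  have hδ : ∀ δ > 0, ‖u z‖ ≤ Real.exp ((δ - Real.log ‖Q 0‖) * k) := fun δ hδ => by
    obtain ⟨p, hp, hp0, hpu, hpδ⟩ := exists_exp_majorant hu hδ
    have hQp : ‖Q 0 * Complex.exp (p 0)‖ ≤ Real.exp δ := by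
      refine norm_le_of_sphere_norm_le (hQ.smul hp.cexp.diffContOnCl) (fun x hx => ?_)
        (Metric.mem_ball_self one_pos)
      have hmax : ‖Q x‖ * max ‖u x‖ 1 ≤ 1 := by
        rw [mul_max_of_nonneg _ _ (norm_nonneg _), max_le_iff, mul_comm, ← norm_mul, mul_one]
        exact ⟨huQ x hx, hQ1 x hx⟩
      calc ‖Q x • Complex.exp (p x)‖ = ‖Q x‖ * Real.exp (p x).re := by
            rw [norm_smul, Complex.norm_exp]
        _ ≤ ‖Q x‖ * (Real.exp δ * max ‖u x‖ 1) := by gcongr; exact hpδ x hx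
        _ ≤ Real.exp δ := by nlinarith [Real.exp_pos δ]
    have hp0' : ‖p 0‖ ≤ δ - Real.log ‖Q 0‖ := by
      have hre : ‖p 0‖ = (p 0).re := by
        rw [← Complex.abs_re_eq_norm.2 hp0, abs_of_nonneg (hpu 0 (by simp)).1]
      rw [norm_mul, Complex.norm_exp, ← hre] at hQp
      have := Real.log_le_log (by positivity) hQp
      rw [Real.log_mul (by positivity) (by positivity), Real.log_exp, Real.log_exp] at this
      linarith
    have hharnack : ‖p z‖ ≤ ‖p 0‖ * k :=
      norm_le_of_re_nonneg_ball hp.differentiableOn (fun x hx => (hpu x hx).1) hz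
    refine (hpu z (by simpa using hz)).2.trans (Real.exp_le_exp.2 ?_)
    exact (Complex.re_le_norm _).trans (hharnack.trans (by gcongr))
  have hlim : Tendsto (fun δ : ℝ => Real.exp ((δ - Real.log ‖Q 0‖) * k)) (𝓝[>] 0)
      (𝓝 (Real.exp (-Real.log ‖Q 0‖ * k))) :=
    (Continuous.tendsto' (by fun_prop) _ _ (by simp)).mono_left nhdsWithin_le_nhds
  exact ge_of_tendsto hlim (eventually_nhdsWithin_of_forall hδ)

theorem norm_le_exp_of_norm_mul_le_one {u Q : ℂ → ℂ}
    (hu : DifferentiableOn ℂ u (Metric.ball 0 1)) (hQ : DifferentiableOn ℂ Q (Metric.ball 0 1))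
    (hQ1 : ∀ z ∈ Metric.ball (0 : ℂ) 1, ‖Q z‖ ≤ 1)
    (huQ : ∀ z ∈ Metric.ball (0 : ℂ) 1, ‖u z * Q z‖ ≤ 1) (hQ0 : Q 0 ≠ 0)
    {z : ℂ} (hz : ‖z‖ < 1) :
    ‖u z‖ ≤ Real.exp (-Real.log ‖Q 0‖ * ((1 + ‖z‖) / (1 - ‖z‖))) := by
  have hdil : ∀ r ∈ Set.Ioo (0 : ℝ) 1, ‖u (r * z)‖ ≤
      Real.exp (-Real.log ‖Q 0‖ * ((1 + ‖z‖) / (1 - ‖z‖))) := fun r hr => by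
    have hmaps : Set.MapsTo (fun ζ : ℂ => r * ζ) (Metric.closedBall 0 1) (Metric.ball 0 1) :=
      fun ζ hζ => by
        rw [mem_closedBall_zero_iff] at hζ
        rw [mem_ball_zero_iff, norm_mul, Complex.norm_of_nonneg hr.1.le]
        nlinarith [hr.1, hr.2, norm_nonneg ζ]
    have hcomp : ∀ {f : ℂ → ℂ}, DifferentiableOn ℂ f (Metric.ball 0 1) →
        DiffContOnCl ℂ (fun ζ => f (r * ζ)) (Metric.ball 0 1) := fun hf => by
      refine DifferentiableOn.diffContOnCl ?_
      rw [closure_ball _ one_ne_zero]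
      exact hf.comp (by fun_prop) hmaps
    have hsphere := Metric.sphere_subset_closedBall (x := (0 : ℂ)) (ε := 1)
    simpa using norm_le_exp_of_norm_mul_le_one_of_diffContOnCl (hcomp hu) (hcomp hQ)
      (fun x hx => hQ1 _ (hmaps (hsphere hx))) (fun x hx => huQ _ (hmaps (hsphere hx)))
      (by simpa using hQ0) hz
  have hlim : Tendsto (fun r : ℝ => ‖u (r * z)‖) (𝓝[<] 1) (𝓝 ‖u z‖) := by
    have hcont : ContinuousAt u ((1 : ℝ) * z) := by
      refine (hu.differentiableAt (Metric.isOpen_ball.mem_nhds ?_)).continuousAt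
      simpa using hz
    have hr : Tendsto (fun r : ℝ => (r : ℂ) * z) (𝓝 1) (𝓝 ((1 : ℝ) * z)) :=
      Continuous.tendsto (by fun_prop) _
    simpa using ((hcont.tendsto.comp hr).norm).mono_left nhdsWithin_le_nhds
  exact le_of_tendsto hlim (by filter_upwards [Ioo_mem_nhdsLT one_pos] with r hr using hdil r hr)

/-- The conformal map of the unit disc onto the upper half-plane that maps `0` to `p`; its inverse
is `upperHalfToDisc p`. -/
noncomputable def discToUpperHalf (p ζ : ℂ) : ℂ := (p - conj p * ζ) / (1 - ζ)

/-- The conformal map of the upper half-plane onto the unit disc that maps `p` to `0`. -/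
noncomputable def upperHalfToDisc (p z : ℂ) : ℂ := (z - p) / (z - conj p)

theorem discToUpperHalf_zero (p : ℂ) : discToUpperHalf p 0 = p := by simp [discToUpperHalf]

theorem one_sub_ne_zero_of_norm_lt_one {ζ : ℂ} (hζ : ‖ζ‖ < 1) : 1 - ζ ≠ 0 :=
  sub_ne_zero.2 fun h => by simp [← h] at hζ

theorem sub_conj_ne_zero {p z : ℂ} (hp : p ∈ upperHalf) (hz : z ∈ upperHalf) : z - conj p ≠ 0 :=
  fun h => by
    have him := congrArg Complex.im h
    simp only [Complex.sub_im, Complex.conj_im, Complex.zero_im] at him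
    linarith [show 0 < p.im from hp, show 0 < z.im from hz]

theorem im_discToUpperHalf (p ζ : ℂ) :
    (discToUpperHalf p ζ).im = p.im * (1 - ‖ζ‖ ^ 2) / ‖1 - ζ‖ ^ 2 := by
  rw [discToUpperHalf, Complex.div_im, ← sub_div, ← Complex.normSq_eq_norm_sq,
    ← Complex.normSq_eq_norm_sq]
  congr 1
  simp only [Complex.normSq_apply, Complex.sub_im, Complex.sub_re, Complex.mul_im, Complex.mul_re,
    Complex.conj_re, Complex.conj_im, Complex.one_re, Complex.one_im]
  ring

theorem mapsTo_discToUpperHalf {p : ℂ} (hp : p ∈ upperHalf) :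
    Set.MapsTo (discToUpperHalf p) (Metric.ball 0 1) upperHalf := fun ζ hζ => by
  rw [mem_ball_zero_iff] at hζ
  have hne := one_sub_ne_zero_of_norm_lt_one hζ
  have hp' : 0 < p.im := hp
  have hsq : 0 < 1 - ‖ζ‖ ^ 2 := by nlinarith [norm_nonneg ζ]
  rw [upperHalf, Set.mem_ofPred_eq, im_discToUpperHalf]
  positivity

theorem differentiableOn_discToUpperHalf (p : ℂ) :
    DifferentiableOn ℂ (discToUpperHalf p) (Metric.ball 0 1) :=
  DifferentiableOn.div (by fun_prop) (by fun_prop) fun _ hζ =>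
    one_sub_ne_zero_of_norm_lt_one (mem_ball_zero_iff.1 hζ)

theorem discToUpperHalf_upperHalfToDisc {p z : ℂ} (hp : p ∈ upperHalf) (hz : z ∈ upperHalf) :
    discToUpperHalf p (upperHalfToDisc p z) = z := by
  have hzp := sub_conj_ne_zero hp hz
  have hpp := sub_conj_ne_zero hp hp
  have hsub : 1 - upperHalfToDisc p z = (p - conj p) / (z - conj p) := by
    rw [upperHalfToDisc]
    field_simp
    ring
  rw [discToUpperHalf, hsub, upperHalfToDisc]
  field_simp
  ring

theorem one_sub_norm_upperHalfToDisc_sq {p z : ℂ} (hp : p ∈ upperHalf) (hz : z ∈ upperHalf) :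
    1 - ‖upperHalfToDisc p z‖ ^ 2 = 4 * p.im * z.im / ‖z - conj p‖ ^ 2 := by
  have hne := norm_ne_zero_iff.2 (sub_conj_ne_zero hp hz)
  rw [upperHalfToDisc, norm_div, div_pow]
  field_simp
  simp only [← Complex.normSq_eq_norm_sq, Complex.normSq_apply, Complex.sub_im, Complex.sub_re,
    Complex.conj_re, Complex.conj_im]
  ring

theorem norm_upperHalfToDisc_lt_one {p z : ℂ} (hp : p ∈ upperHalf) (hz : z ∈ upperHalf) :
    ‖upperHalfToDisc p z‖ < 1 := by
  have hp' : 0 < p.im := hp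
  have hz' : 0 < z.im := hz
  have hne := sub_conj_ne_zero hp hz
  have : 0 < 4 * p.im * z.im / ‖z - conj p‖ ^ 2 := by positivity
  rw [← one_sub_norm_upperHalfToDisc_sq hp hz] at this
  exact (sq_lt_one_iff₀ (norm_nonneg _)).1 (by linarith)

theorem one_add_norm_div_one_sub_norm_upperHalfToDisc_le {p z : ℂ} (hp : p ∈ upperHalf)
    (hz : z ∈ upperHalf) :
    (1 + ‖upperHalfToDisc p z‖) / (1 - ‖upperHalfToDisc p z‖) ≤
      (1 + ‖p‖) ^ 2 / p.im * ((1 + ‖z‖) ^ 2 / z.im) := by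
  have hp' : 0 < p.im := hp
  have hz' : 0 < z.im := hz
  have hs := norm_upperHalfToDisc_lt_one hp hz
  have hsq := one_sub_norm_upperHalfToDisc_sq hp hz
  have hne := sub_conj_ne_zero hp hz
  set s := ‖upperHalfToDisc p z‖
  have hs0 : 1 - s ≠ 0 := by linarith
  have hs1 : 0 < 1 + s := by linarith [norm_nonneg (upperHalfToDisc p z)]
  have hnorm : ‖z - conj p‖ ≤ (1 + ‖p‖) * (1 + ‖z‖) := by
    have := norm_sub_le z (conj p)
    rw [RCLike.norm_conj] at this
    nlinarith [norm_nonneg z, norm_nonneg p]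
  calc (1 + s) / (1 - s) = (1 + s) ^ 2 / (1 - s ^ 2) := by
        rw [show 1 - s ^ 2 = (1 - s) * (1 + s) by ring]
        field_simp
    _ ≤ 2 ^ 2 / (1 - s ^ 2) := by
        gcongr
        · rw [hsq]; positivity
        · linarith
    _ = ‖z - conj p‖ ^ 2 / (p.im * z.im) := by rw [hsq]; field_simp; ring
    _ ≤ ((1 + ‖p‖) * (1 + ‖z‖)) ^ 2 / (p.im * z.im) := by gcongr
    _ = _ := by field_simp

/-- `u` has at most the growth of a function of bounded type in the upper half-plane. -/
def HasNevanlinnaGrowth (u : ℂ → ℂ) : Prop :=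
  ∃ C : ℝ, 0 ≤ C ∧ ∀ z ∈ upperHalf, ‖u z‖ ≤ Real.exp (C * ((1 + ‖z‖) ^ 2 / z.im))

theorem IsBoundedType.hasNevanlinnaGrowth {u : ℂ → ℂ} (hu : DifferentiableOn ℂ u upperHalf)
    (h : IsBoundedType u) : HasNevanlinnaGrowth u := by
  obtain ⟨P, Q, -, hQ, ⟨a, ha⟩, ⟨b, hb⟩, ⟨p, hp, hQp⟩, huQ⟩ := h
  set m : ℝ := max (max a b) 1
  have hm : 0 < m := one_pos.trans_le (le_max_right _ _)
  have hmaps := mapsTo_discToUpperHalf hp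
  have hdiv : ∀ {x : ℂ}, ‖x‖ ≤ m → ‖x / m‖ ≤ 1 := fun hx => by
    rwa [norm_div, Complex.norm_of_nonneg hm.le, div_le_one hm]
  have hbm : ∀ z ∈ upperHalf, ‖Q z / m‖ ≤ 1 := fun z hz =>
    hdiv ((hb z hz).trans ((le_max_right _ _).trans (le_max_left _ _)))
  have ham : ∀ z ∈ upperHalf, ‖u z * (Q z / m)‖ ≤ 1 := fun z hz => by
    rw [← mul_div_assoc, huQ z hz]
    exact hdiv ((ha z hz).trans ((le_max_left _ _).trans (le_max_left _ _)))
  have hM : 0 ≤ -Real.log ‖Q p / m‖ :=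
    neg_nonneg.2 (Real.log_nonpos (norm_nonneg _) (hbm p hp))
  have hp' : 0 < p.im := hp
  refine ⟨-Real.log ‖Q p / m‖ * ((1 + ‖p‖) ^ 2 / p.im), by positivity, fun z hz => ?_⟩
  have key := norm_le_exp_of_norm_mul_le_one
    (hu.comp (differentiableOn_discToUpperHalf p) hmaps)
    ((hQ.comp (differentiableOn_discToUpperHalf p) hmaps).div_const (m : ℂ))
    (fun ζ hζ => hbm _ (hmaps hζ)) (fun ζ hζ => ham _ (hmaps hζ))
    (by simpa [discToUpperHalf_zero, hm.ne'] using hQp) (norm_upperHalfToDisc_lt_one hp hz)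
  simp only [Function.comp_apply, discToUpperHalf_zero,
    discToUpperHalf_upperHalfToDisc hp hz] at key
  refine key.trans (Real.exp_le_exp.2 ?_)
  rw [mul_assoc (-Real.log _)]
  exact mul_le_mul_of_nonneg_left (one_add_norm_div_one_sub_norm_upperHalfToDisc_le hp hz) hM

theorem exists_norm_le_of_re_nonneg {S : ℂ → ℂ} (hS : DifferentiableOn ℂ S upperHalf)
    (hre : ∀ z ∈ upperHalf, 0 ≤ (S z).re) :
    ∃ C : ℝ, ∀ z ∈ upperHalf, ‖S z‖ ≤ C * ((1 + ‖z‖) ^ 2 / z.im) := by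
  have hI := I_mem_upperHalf
  have hmaps := mapsTo_discToUpperHalf hI
  refine ⟨‖S Complex.I‖ * ((1 + ‖Complex.I‖) ^ 2 / Complex.I.im), fun z hz => ?_⟩
  have key := norm_le_of_re_nonneg_ball (hS.comp (differentiableOn_discToUpperHalf _) hmaps)
    (fun ζ hζ => hre _ (hmaps hζ)) (norm_upperHalfToDisc_lt_one hI hz)
  simp only [Function.comp_apply, discToUpperHalf_zero,
    discToUpperHalf_upperHalfToDisc hI hz] at key
  refine key.trans ?_
  rw [mul_assoc]
  exact mul_le_mul_of_nonneg_left (one_add_norm_div_one_sub_norm_upperHalfToDisc_le hI hz)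
    (norm_nonneg _)

theorem im_div_one_sub_mul_sq (s : ℝ) (z : ℂ) :
    (z / (1 - (s * z) ^ 2)).im = z.im * (1 + (s * ‖z‖) ^ 2) / ‖1 - (s * z) ^ 2‖ ^ 2 := by
  rw [Complex.div_im, ← sub_div, mul_pow s, ← Complex.normSq_eq_norm_sq,
    ← Complex.normSq_eq_norm_sq]
  congr 1
  simp only [Complex.normSq_apply, pow_two, Complex.sub_re, Complex.sub_im, Complex.mul_re,
    Complex.mul_im, Complex.ofReal_re, Complex.ofReal_im, Complex.one_re, Complex.one_im]
  ring

theorem im_div_one_sub_mul_sq_nonneg (s : ℝ) {z : ℂ} (hz : 0 ≤ z.im) :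
    0 ≤ (z / (1 - (s * z) ^ 2)).im := by
  rw [im_div_one_sub_mul_sq]
  positivity

theorem im_div_one_sub_mul_sq_of_mul_norm_eq_one {s : ℝ} (hs : 0 < s) {z : ℂ} (hz : 0 < z.im)
    (h : s * ‖z‖ = 1) : (z / (1 - (s * z) ^ 2)).im = 1 / (2 * s ^ 2 * z.im) := by
  have hfac : 1 - ((s : ℂ) * z) ^ 2 = s ^ 2 * z * (conj z - z) := by
    have hone : (s : ℂ) ^ 2 * (z * conj z) = 1 := by
      rw [Complex.mul_conj', ← mul_pow]
      exact_mod_cast congrArg (· ^ 2) h |>.trans (one_pow 2)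
    linear_combination -hone
  have him : ‖conj z - z‖ = 2 * z.im := by
    rw [← norm_neg, neg_sub, Complex.sub_conj, norm_mul, Complex.norm_I, mul_one,
      Complex.norm_of_nonneg (by positivity)]
  have hden : ‖1 - ((s : ℂ) * z) ^ 2‖ = 2 * s * z.im := by
    rw [hfac, norm_mul, norm_mul, norm_pow, him, Complex.norm_of_nonneg hs.le]
    linear_combination (2 * s * z.im) * h
  rw [im_div_one_sub_mul_sq, hden, h]
  field_simp
  norm_num

theorem one_sub_ofReal_mul_sq_ne_zero (s : ℝ) {z : ℂ} (hz : 0 < z.im) :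
    1 - ((s : ℂ) * z) ^ 2 ≠ 0 := fun h => by
  have hsq : ((s : ℂ) * z) * (s * z) = 1 := by linear_combination -h
  have him : ((s : ℂ) * z).im = 0 := by
    rcases mul_self_eq_one_iff.1 hsq with h1 | h1 <;> simp [h1]
  rw [Complex.im_ofReal_mul, mul_eq_zero, or_iff_left hz.ne'] at him
  simp [him] at h

/-! ### The Phragmén–Lindelöf principle in the half-plane -/

theorem frontier_upperHalf_inter_ball_subset (R : ℝ) :
    frontier (upperHalf ∩ Metric.ball 0 R) ⊆ {z | z.im = 0} ∪ {z | 0 < z.im ∧ ‖z‖ = R} := by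
  have hfr : frontier upperHalf = {z | z.im = 0} := Complex.frontier_setOfPred_lt_im 0
  have hcl : closure upperHalf = {z | 0 ≤ z.im} := Complex.closure_setOfPred_lt_im 0
  intro z hz
  rcases frontier_inter_subset _ _ hz with ⟨h, -⟩ | ⟨h, hR⟩
  · exact .inl (hfr ▸ h)
  · rw [hcl] at h
    have hR' := Metric.frontier_ball_subset_sphere hR
    rcases (show 0 ≤ z.im from h).eq_or_lt with h0 | h0
    · exact .inl h0.symm
    · exact .inr ⟨h0, mem_sphere_zero_iff_norm.1 hR'⟩

theorem norm_le_of_halfDisc {f : ℂ → ℂ} (hf : DifferentiableOn ℂ f upperHalf) {B R : ℝ}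
    (hreal : ∀ t : ℝ, ∀ c > B, ∀ᶠ z in 𝓝[upperHalf] (t : ℂ), ‖f z‖ ≤ c)
    (harc : ∀ ζ ∈ upperHalf, ‖ζ‖ = R → ∀ c > B, ∀ᶠ z in 𝓝[upperHalf] ζ, ‖f z‖ ≤ c)
    {z : ℂ} (hz : z ∈ upperHalf) (hzR : ‖z‖ < R) : ‖f z‖ ≤ B := by
  refine norm_le_of_frontier_eventually_le (isOpen_upperHalf.inter Metric.isOpen_ball)
    (Metric.isBounded_ball.subset Set.inter_subset_right) (hf.mono Set.inter_subset_left)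
    (fun ζ hζ c hc => ?_) ⟨hz, mem_ball_zero_iff.2 hzR⟩
  refine Eventually.filter_mono (nhdsWithin_mono _ Set.inter_subset_left) ?_
  rcases frontier_upperHalf_inter_ball_subset _ hζ with him | ⟨him, hR⟩
  · rw [show ζ = (ζ.re : ℂ) from Complex.ext (by simp) (by simpa using him)]
    exact hreal ζ.re c hc
  · exact harc ζ him hR c hc

theorem one_add_norm_sq_div_im_of_mul_norm_eq_one {s : ℝ} (hs : 0 < s) {z : ℂ} (hz : 0 < z.im)
    (h : s * ‖z‖ = 1) :
    (1 + ‖z‖) ^ 2 / z.im = 2 * (1 + s) ^ 2 * (z / (1 - (s * z) ^ 2)).im := by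
  rw [im_div_one_sub_mul_sq_of_mul_norm_eq_one hs hz h, eq_inv_of_mul_eq_one_right h]
  field_simp
  ring

/-- The multiplier `exp (2 i C (1 + s)² z / (1 - (s z)²))` is at most one in modulus and exactly
compensates the growth of `w` on the half-circle of radius `1 / s`. -/
theorem norm_le_exp_of_mul_norm_lt_one {w : ℂ → ℂ} (hw : DifferentiableOn ℂ w upperHalf)
    {C : ℝ} (hC : 0 ≤ C)
    (hwC : ∀ z ∈ upperHalf, ‖w z‖ ≤ Real.exp (C * ((1 + ‖z‖) ^ 2 / z.im)))
    (hb : ∀ t : ℝ, ∀ c > 1, ∀ᶠ z in 𝓝[upperHalf] (t : ℂ), ‖w z‖ ≤ c)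
    {z : ℂ} (hz : z ∈ upperHalf) {s : ℝ} (hs : 0 < s) (hsz : s * ‖z‖ < 1) :
    ‖w z‖ ≤ Real.exp (2 * C * (1 + s) ^ 2 * (z / (1 - (s * z) ^ 2)).im) := by
  set A : ℝ := 2 * C * (1 + s) ^ 2
  have hA : 0 ≤ A := by positivity
  set H : ℂ → ℂ := fun x => A * Complex.I * (x / (1 - (s * x) ^ 2))
  have hHre : ∀ x, (H x).re = -(A * (x / (1 - (s * x) ^ 2)).im) := fun x => by
    simp only [H]
    rw [mul_assoc, Complex.re_ofReal_mul, Complex.I_mul_re, mul_neg]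
  have hHd : ∀ x ∈ upperHalf, DifferentiableAt ℂ H x := fun x hx => by
    have := one_sub_ofReal_mul_sq_ne_zero s hx
    fun_prop (disch := assumption)
  suffices h : ‖w z * Complex.exp (H z)‖ ≤ 1 by
    rwa [norm_mul, Complex.norm_exp, hHre, Real.exp_neg, ← div_eq_mul_inv,
      div_le_one (Real.exp_pos _)] at h
  refine norm_le_of_halfDisc (f := fun x => w x * Complex.exp (H x)) (R := s⁻¹)
    (hw.mul fun x hx => (hHd x hx).cexp.differentiableWithinAt) (fun t c hc => ?_)
    (fun ζ him hR c hc => ?_) hz (by rwa [← one_div, lt_div_iff₀' hs])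
  · filter_upwards [hb t c hc, self_mem_nhdsWithin] with x hx hxU
    rw [norm_mul, Complex.norm_exp, hHre]
    refine (mul_le_of_le_one_right (norm_nonneg _) (Real.exp_le_one_iff.2 ?_)).trans hx
    exact neg_nonpos.2 (mul_nonneg hA (im_div_one_sub_mul_sq_nonneg s (le_of_lt hxU)))
  · have hcont : ContinuousAt
        (fun x : ℂ => Real.exp (C * ((1 + ‖x‖) ^ 2 / x.im) + (H x).re)) ζ := by
      have := Complex.continuous_re.continuousAt.comp (hHd ζ him).continuousAt
      exact ((continuousAt_const.mul (ContinuousAt.div (by fun_prop) (by fun_prop)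
        (ne_of_gt him))).add this).rexp
    have hval : C * ((1 + ‖ζ‖) ^ 2 / ζ.im) + (H ζ).re = 0 := by
      rw [hHre, one_add_norm_sq_div_im_of_mul_norm_eq_one hs him
        (by rw [hR, mul_inv_cancel₀ hs.ne'])]
      ring
    have hlt : ∀ᶠ x in 𝓝 ζ, Real.exp (C * ((1 + ‖x‖) ^ 2 / x.im) + (H x).re) < c :=
      hcont.eventually_lt_const (by beta_reduce; rwa [hval, Real.exp_zero])
    filter_upwards [nhdsWithin_le_nhds hlt, self_mem_nhdsWithin] with x hx hxU
    rw [norm_mul, Complex.norm_exp]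
    refine le_trans ?_ hx.le
    rw [Real.exp_add]
    exact mul_le_mul_of_nonneg_right (hwC x hxU) (Real.exp_pos _).le

theorem HasNevanlinnaGrowth.exists_norm_le_exp_mul_im {w : ℂ → ℂ} (hg : HasNevanlinnaGrowth w)
    (hw : DifferentiableOn ℂ w upperHalf)
    (hb : ∀ t : ℝ, ∀ c > 1, ∀ᶠ z in 𝓝[upperHalf] (t : ℂ), ‖w z‖ ≤ c) :
    ∃ C : ℝ, 0 ≤ C ∧ ∀ z ∈ upperHalf, ‖w z‖ ≤ Real.exp (C * z.im) := by
  obtain ⟨C, hC, hwC⟩ := hg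
  refine ⟨2 * C, by positivity, fun z hz => ?_⟩
  have hlim : Tendsto (fun s : ℝ => Real.exp (2 * C * (1 + s) ^ 2 * (z / (1 - (s * z) ^ 2)).im))
      (𝓝 0) (𝓝 (Real.exp (2 * C * z.im))) := by
    have hcont : ContinuousAt (fun s : ℝ =>
        Real.exp (2 * C * (1 + s) ^ 2 * (z / (1 - (s * z) ^ 2)).im)) 0 := by
      have hdiv : ContinuousAt (fun s : ℝ => z / (1 - (s * z) ^ 2)) 0 :=
        ContinuousAt.div (by fun_prop) (by fun_prop) (by simp)
      have := Complex.continuous_im.continuousAt.comp hdiv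
      exact (ContinuousAt.mul (by fun_prop) this).rexp
    simpa using hcont.tendsto
  have hsmall : ∀ᶠ s : ℝ in 𝓝[>] 0, s * ‖z‖ < 1 :=
    nhdsWithin_le_nhds (Continuous.tendsto' (by fun_prop) _ 0 (by simp) |>.eventually_lt_const
      one_pos)
  refine ge_of_tendsto (hlim.mono_left (nhdsWithin_le_nhds (s := Set.Ioi 0))) ?_
  filter_upwards [self_mem_nhdsWithin, hsmall] with s hs hsz
  exact norm_le_exp_of_mul_norm_lt_one hw hC hwC hb hz hs hsz

theorem norm_le_of_bounded_on_imaginary_axis {f : ℂ → ℂ}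
    (hf : ∀ z : ℂ, 0 ≤ z.im → DifferentiableAt ℂ f z) {A B C M : ℝ} (hC : 0 ≤ C)
    (hexp : ∀ z : ℂ, 0 ≤ z.im → ‖f z‖ ≤ A * Real.exp (C * z.im))
    (him : ∀ᶠ y : ℝ in atTop, ‖f (y * Complex.I)‖ ≤ M) (hreal : ∀ t : ℝ, ‖f t‖ ≤ B)
    {z : ℂ} (hz : 0 ≤ z.im) : ‖f z‖ ≤ B := by
  have hrot : ∀ x : ℂ, 0 ≤ x.re → 0 ≤ (x * Complex.I).im := fun x hx => by
    rwa [Complex.mul_I_im]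
  have hcl : closure {x : ℂ | 0 < x.re} = {x : ℂ | 0 ≤ x.re} := Complex.closure_setOfPred_lt_re 0
  have hd : DiffContOnCl ℂ (fun x => f (x * Complex.I)) {x : ℂ | 0 < x.re} := by
    refine DifferentiableOn.diffContOnCl fun x hx => ?_
    rw [hcl] at hx
    exact (DifferentiableAt.comp x (hf _ (hrot x hx)) (by fun_prop)).differentiableWithinAt
  have hA : 0 ≤ A := by
    have := (norm_nonneg _).trans (hexp 0 le_rfl)
    exact nonneg_of_mul_nonneg_left this (Real.exp_pos _)
  have hO : (fun x => f (x * Complex.I)) =O[Bornology.cobounded ℂ ⊓ 𝓟 {x : ℂ | 0 < x.re}]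
      fun x => Real.exp (C * ‖x‖ ^ (1 : ℝ)) := by
    refine Asymptotics.IsBigO.of_bound A (eventually_inf_principal.2 (.of_forall fun x hx => ?_))
    refine (hexp _ (hrot x (le_of_lt hx))).trans ?_
    rw [Real.norm_eq_abs, Real.abs_exp, Real.rpow_one, Complex.mul_I_im]
    gcongr
    exact Complex.re_le_norm x
  have key := PhragmenLindelof.right_half_plane_of_bounded_on_real (z := -Complex.I * z) hd
    ⟨1, one_lt_two, C, hO⟩ ⟨M, eventually_map.2 him⟩ (C := B) (fun y => by
      simpa [mul_assoc] using hreal (-y)) (by simpa using hz)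
  rwa [show -Complex.I * z * Complex.I = z by linear_combination (-z) * Complex.I_mul_I] at key

theorem norm_le_of_norm_le_exp_mul_im {w : ℂ → ℂ} (hw : DifferentiableOn ℂ w upperHalf)
    {C : ℝ} (hC : 0 ≤ C) (h : ∀ z ∈ upperHalf, ‖w z‖ ≤ Real.exp (C * z.im))
    (hm : meanType w ≤ 0) {z : ℂ} (hz : z ∈ upperHalf) : ‖w z‖ ≤ 1 := by
  have hz' : 0 < z.im := hz
  rw [meanType_nonpos_iff] at hm
  have key : ∀ t ∈ Set.Ioo 0 z.im, ‖w z‖ ≤ Real.exp (C * t) * Real.exp (t * (z.im - t)) := by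
    rintro t ⟨ht, htz⟩
    set f : ℂ → ℂ := fun x => w (x + t * Complex.I) * Complex.exp (t * (x * Complex.I))
    have hmem : ∀ x : ℂ, 0 ≤ x.im → x + t * Complex.I ∈ upperHalf := fun x hx => by
      simpa [upperHalf] using add_pos_of_nonneg_of_pos hx ht
    have hfn : ∀ x : ℂ, ‖f x‖ = ‖w (x + t * Complex.I)‖ * Real.exp (-(t * x.im)) := fun x => by
      rw [norm_mul, Complex.norm_exp, Complex.re_ofReal_mul, Complex.mul_I_re, mul_neg]
    have hle : ∀ x : ℂ, 0 ≤ x.im → ‖f x‖ ≤ Real.exp (C * t) * Real.exp (C * x.im) := fun x hx => by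
      rw [hfn, ← Real.exp_add, ← mul_add, add_comm t]
      refine (mul_le_of_le_one_right (norm_nonneg _) (Real.exp_le_one_iff.2 ?_)).trans ?_
      · exact neg_nonpos.2 (by positivity)
      · simpa using h _ (hmem x hx)
    have hfd : ∀ x : ℂ, 0 ≤ x.im → DifferentiableAt ℂ f x := fun x hx => by
      have := hw.differentiableAt (isOpen_upperHalf.mem_nhds (hmem x hx))
      exact (DifferentiableAt.comp x this (by fun_prop)).mul (by fun_prop)
    have hfim : ∀ᶠ y : ℝ in atTop, ‖f (y * Complex.I)‖ ≤ Real.exp (t * t) := by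
      filter_upwards [(tendsto_atTop_add_const_right atTop t tendsto_id).eventually (hm t ht)]
        with y hy
      rw [id, Complex.ofReal_add, add_mul] at hy
      rw [hfn, show (y * Complex.I : ℂ).im = y by simp, Real.exp_neg, ← div_eq_mul_inv,
        div_le_iff₀ (Real.exp_pos _), ← Real.exp_add, ← mul_add, add_comm t]
      exact hy
    have hfin := norm_le_of_bounded_on_imaginary_axis (z := z - t * Complex.I) hfd hC hle hfim
      (fun s => by simpa using hle s (by simp)) (by simpa using htz.le)
    rw [hfn, sub_add_cancel, Real.exp_neg, ← div_eq_mul_inv, div_le_iff₀ (Real.exp_pos _)] at hfin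
    simpa using hfin
  have hlim : Tendsto (fun t : ℝ => Real.exp (C * t) * Real.exp (t * (z.im - t)))
      (𝓝[>] 0) (𝓝 1) :=
    (Continuous.tendsto' (by fun_prop) _ _ (by simp)).mono_left nhdsWithin_le_nhds
  exact ge_of_tendsto hlim (by filter_upwards [Ioo_mem_nhdsGT hz'] with t ht using key t ht)

theorem HasNevanlinnaGrowth.norm_le_one {w : ℂ → ℂ} (hg : HasNevanlinnaGrowth w)
    (hw : DifferentiableOn ℂ w upperHalf)
    (hb : ∀ t : ℝ, ∀ c > 1, ∀ᶠ z in 𝓝[upperHalf] (t : ℂ), ‖w z‖ ≤ c)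
    (hm : meanType w ≤ 0) {z : ℂ} (hz : z ∈ upperHalf) : ‖w z‖ ≤ 1 := by
  obtain ⟨C, hC, h⟩ := hg.exists_norm_le_exp_mul_im hw hb
  exact norm_le_of_norm_le_exp_mul_im hw hC h hm hz

/-! ### Poisson majorants and the Cauchy formula -/

theorem closure_upperHalf : closure upperHalf = {z : ℂ | 0 ≤ z.im} :=
  Complex.closure_setOfPred_lt_im 0

theorem ofReal_sub_ne_zero {z : ℂ} (hz : z.im ≠ 0) (t : ℝ) : (t : ℂ) - z ≠ 0 := fun h =>
  hz (by simpa using congrArg Complex.im h)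

/-- The Poisson kernel of the upper half-plane: harmonic in `z`, and of total mass `1` in `t`. -/
noncomputable def upperHalfPoisson (z : ℂ) (t : ℝ) : ℝ := Real.pi⁻¹ * (z.im / ‖(t : ℂ) - z‖ ^ 2)

theorem upperHalfPoisson_eq (z : ℂ) (t : ℝ) :
    upperHalfPoisson z t = Real.pi⁻¹ * (z.im⁻¹ * (1 + ((t - z.re) / z.im) ^ 2)⁻¹) := by
  rcases eq_or_ne z.im 0 with hz | hz
  · simp [upperHalfPoisson, hz]
  rw [upperHalfPoisson, ← Complex.normSq_eq_norm_sq, Complex.normSq_apply]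
  simp only [Complex.sub_re, Complex.ofReal_re, Complex.sub_im, Complex.ofReal_im]
  field_simp
  ring

theorem continuous_upperHalfPoisson (z : ℂ) : Continuous (upperHalfPoisson z) := by
  have : upperHalfPoisson z = _ := funext (upperHalfPoisson_eq z)
  rw [this]
  exact continuous_const.mul <| continuous_const.mul <|
    Continuous.inv₀ (by fun_prop) fun t => by positivity

theorem upperHalfPoisson_nonneg {z : ℂ} (hz : 0 ≤ z.im) (t : ℝ) : 0 ≤ upperHalfPoisson z t := by
  unfold upperHalfPoisson; positivity

theorem upperHalfPoisson_le {z : ℂ} (hz : 0 < z.im) (t : ℝ) :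
    upperHalfPoisson z t ≤ (Real.pi * z.im)⁻¹ := by
  rw [upperHalfPoisson_eq, mul_inv]
  gcongr
  exact mul_le_of_le_one_right (by positivity)
    (inv_le_one_of_one_le₀ (le_add_of_nonneg_right (sq_nonneg _)))

theorem integrable_upperHalfPoisson {z : ℂ} (hz : z.im ≠ 0) : Integrable (upperHalfPoisson z) := by
  have : upperHalfPoisson z = _ := funext (upperHalfPoisson_eq z)
  rw [this]
  exact (((integrable_inv_one_add_sq.comp_div hz).comp_sub_right z.re).const_mul _).const_mul _

theorem integral_upperHalfPoisson {z : ℂ} (hz : 0 < z.im) : ∫ t, upperHalfPoisson z t = 1 := by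
  simp_rw [upperHalfPoisson_eq]
  rw [integral_const_mul, integral_const_mul,
    integral_sub_right_eq_self (fun t : ℝ => (1 + (t / z.im) ^ 2)⁻¹) z.re,
    Measure.integral_comp_div (fun t : ℝ => (1 + t ^ 2)⁻¹), integral_univ_inv_one_add_sq,
    smul_eq_mul, abs_of_pos hz]
  field_simp

theorem intervalIntegral_upperHalfPoisson {z : ℂ} (hz : z.im ≠ 0) (a b : ℝ) :
    ∫ t in a..b, upperHalfPoisson z t =
      Real.pi⁻¹ * (Real.arctan ((b - z.re) / z.im) - Real.arctan ((a - z.re) / z.im)) := by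
  simp_rw [upperHalfPoisson_eq]
  rw [intervalIntegral.integral_const_mul, intervalIntegral.integral_const_mul,
    intervalIntegral.integral_comp_sub_right (fun t => (1 + (t / z.im) ^ 2)⁻¹),
    intervalIntegral.integral_comp_div (fun t => (1 + t ^ 2)⁻¹) hz, integral_inv_one_add_sq,
    smul_eq_mul, inv_mul_cancel_left₀ hz]

theorem tendsto_intervalIntegral_upperHalfPoisson {a b x : ℝ} (ha : a < x) (hb : x < b) :
    Tendsto (fun z => ∫ t in a..b, upperHalfPoisson z t) (𝓝[upperHalf] (x : ℂ)) (𝓝 1) := by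
  have hre : Tendsto Complex.re (𝓝[upperHalf] (x : ℂ)) (𝓝 x) :=
    (Complex.continuous_re.tendsto' _ _ (Complex.ofReal_re x)).mono_left nhdsWithin_le_nhds
  have him : Tendsto (fun z : ℂ => z.im⁻¹) (𝓝[upperHalf] (x : ℂ)) atTop := by
    refine tendsto_inv_nhdsGT_zero.comp (tendsto_nhdsWithin_iff.2 ⟨?_, self_mem_nhdsWithin⟩)
    exact (Complex.continuous_im.tendsto' _ _ (Complex.ofReal_im x)).mono_left nhdsWithin_le_nhds
  have hright : Tendsto (fun z : ℂ => Real.arctan ((b - z.re) / z.im)) (𝓝[upperHalf] (x : ℂ))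
      (𝓝 (Real.pi / 2)) :=
    (Real.tendsto_arctan_atTop.mono_right nhdsWithin_le_nhds).comp
      ((tendsto_const_nhds.sub hre).pos_mul_atTop (sub_pos.2 hb) him)
  have hleft : Tendsto (fun z : ℂ => Real.arctan ((a - z.re) / z.im)) (𝓝[upperHalf] (x : ℂ))
      (𝓝 (-(Real.pi / 2))) :=
    (Real.tendsto_arctan_atBot.mono_right nhdsWithin_le_nhds).comp
      ((tendsto_const_nhds.sub hre).neg_mul_atTop (sub_neg.2 ha) him)
  refine Tendsto.congr' (eventually_mem_nhdsWithin.mono fun z (hz : 0 < z.im) =>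
    (intervalIntegral_upperHalfPoisson hz.ne' a b).symm) ?_
  have hpi : Real.pi⁻¹ * (Real.pi / 2 - -(Real.pi / 2)) = 1 := by field_simp; ring
  simpa only [hpi] using (hright.sub hleft).const_mul Real.pi⁻¹

theorem tendstoUniformlyOn_upperHalfPoisson_zero {x : ℝ} {u : Set ℝ} (hu : u ∈ 𝓝 x) :
    TendstoUniformlyOn upperHalfPoisson 0 (𝓝[upperHalf] (x : ℂ)) (Set.univ \ u) := by
  obtain ⟨δ, hδ, hball⟩ := Metric.mem_nhds_iff.1 hu
  have hlim : Tendsto (fun z : ℂ => Real.pi⁻¹ * (z.im / (δ / 2) ^ 2)) (𝓝[upperHalf] (x : ℂ))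
      (𝓝 0) :=
    (Continuous.tendsto' (by fun_prop) _ _ (by simp)).mono_left nhdsWithin_le_nhds
  refine Metric.tendstoUniformlyOn_iff.2 fun ε hε => ?_
  filter_upwards [hlim.eventually_lt_const hε, self_mem_nhdsWithin,
    nhdsWithin_le_nhds (Metric.ball_mem_nhds (x : ℂ) (half_pos hδ))] with z hz hz' hzx t ht
  have hfar : δ / 2 ≤ ‖(t : ℂ) - z‖ := by
    have htx : δ ≤ ‖(t : ℂ) - x‖ := by
      rw [← Complex.ofReal_sub, Complex.norm_real]
      exact not_lt.1 fun h => ht.2 (hball (by simpa [Real.dist_eq] using h))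
    have := norm_sub_le_norm_sub_add_norm_sub (t : ℂ) z x
    have hzx' : ‖z - x‖ < δ / 2 := mem_ball_iff_norm.1 hzx
    linarith
  have him : 0 ≤ z.im := le_of_lt hz'
  rw [Pi.zero_apply, dist_zero_left, Real.norm_of_nonneg (upperHalfPoisson_nonneg him t)]
  refine lt_of_le_of_lt ?_ hz
  unfold upperHalfPoisson
  gcongr

theorem tendsto_integral_upperHalfPoisson_mul {p : ℝ → ℝ} (hp : Integrable p) {x : ℝ}
    (hx : ContinuousAt p x) :
    Tendsto (fun z => ∫ t, upperHalfPoisson z t * p t) (𝓝[upperHalf] (x : ℂ)) (𝓝 (p x)) := by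
  simp_rw [← smul_eq_mul, ← setIntegral_univ (μ := volume)]
  refine tendsto_setIntegral_peak_smul_of_integrableOn_of_tendsto (t := Set.Ioc (x - 1) (x + 1))
    (x₀ := x) MeasurableSet.univ measurableSet_Ioc (Set.subset_univ _) ?_ measure_Ioc_lt_top.ne ?_
    (fun u hu hxu => tendstoUniformlyOn_upperHalfPoisson_zero (hu.mem_nhds hxu)) ?_ ?_
    hp.integrableOn ?_
  · exact mem_nhdsWithin_of_mem_nhds (Ioc_mem_nhds (by linarith) (by linarith))
  · filter_upwards [self_mem_nhdsWithin] with z hz t _ using upperHalfPoisson_nonneg (le_of_lt hz) t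
  · simp_rw [← intervalIntegral.integral_of_le (show x - 1 ≤ x + 1 by linarith)]
    exact tendsto_intervalIntegral_upperHalfPoisson (by linarith) (by linarith)
  · exact .of_forall fun z => (continuous_upperHalfPoisson z).aestronglyMeasurable
  · exact hx.mono_left nhdsWithin_le_nhds

/-- The Herglotz transform of a density `p` on the real line, the analytic function on the upper
half-plane whose real part is the Poisson integral of `p`. -/
noncomputable def herglotz (p : ℝ → ℝ) (z : ℂ) : ℂ :=
  (Real.pi * Complex.I)⁻¹ * ∫ t : ℝ, (p t : ℂ) / (t - z)

section Herglotz

variable {p : ℝ → ℝ} {z : ℂ}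

theorem integrable_div_ofReal_sub (hp : Integrable p) (hz : z ∈ upperHalf) :
    Integrable fun t : ℝ => (p t : ℂ) / (t - z) := by
  have hz' : 0 < z.im := hz
  simp_rw [div_eq_mul_inv]
  refine hp.ofReal.mul_bdd (c := z.im⁻¹) ?_ (.of_forall fun t => ?_)
  · exact (Continuous.inv₀ (by fun_prop) (ofReal_sub_ne_zero hz'.ne')).aestronglyMeasurable
  · rw [norm_inv]
    gcongr
    simpa [abs_of_pos hz'] using Complex.abs_im_le_norm ((t : ℂ) - z)

theorem herglotz_re (hp : Integrable p) (hz : z ∈ upperHalf) :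
    (herglotz p z).re = ∫ t, upperHalfPoisson z t * p t := by
  have h : herglotz p z = ∫ t : ℝ, (Real.pi * Complex.I)⁻¹ * ((p t : ℂ) / (t - z)) :=
    (integral_const_mul _ _).symm
  rw [h, ← RCLike.re_eq_complex_re, ← integral_re ((integrable_div_ofReal_sub hp hz).const_mul _)]
  congr 1 with t
  have hpi : (Real.pi * Complex.I : ℂ)⁻¹ = (Real.pi⁻¹ : ℝ) * -Complex.I := by
    rw [mul_inv, Complex.inv_I, Complex.ofReal_inv]
  rw [RCLike.re_eq_complex_re, hpi, mul_assoc, Complex.re_ofReal_mul, neg_mul, Complex.neg_re,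
    Complex.I_mul_re, neg_neg, div_eq_mul_inv, Complex.im_ofReal_mul, Complex.inv_im,
    Complex.sub_im, Complex.ofReal_im, zero_sub, neg_neg, Complex.normSq_eq_norm_sq,
    upperHalfPoisson]
  ring

theorem differentiableOn_herglotz (hp : Integrable p) :
    DifferentiableOn ℂ (herglotz p) upperHalf := by
  intro z hz
  have hz' : 0 < z.im := hz
  set s : Set ℂ := {w | z.im / 2 < w.im}
  have hs : s ∈ 𝓝 z :=
    (isOpen_lt continuous_const Complex.continuous_im).mem_nhds (half_lt_self hz')
  have him : ∀ w ∈ s, 0 < w.im := fun w hw => (half_pos hz').trans hw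
  have hderiv : ∀ t : ℝ, ∀ w ∈ s, HasDerivAt (fun w : ℂ => (p t : ℂ) / (t - w))
      (p t / (t - w) ^ 2) w := fun t w hw => by
    simpa [div_eq_mul_inv] using (((hasDerivAt_id w).const_sub (t : ℂ)).inv
      (ofReal_sub_ne_zero (him w hw).ne' t)).const_mul (p t : ℂ)
  have hbound : ∀ t : ℝ, ∀ w ∈ s, ‖(p t : ℂ) / (t - w) ^ 2‖ ≤ ‖p t‖ * ((z.im / 2) ^ 2)⁻¹ :=
    fun t w hw => by
    rw [norm_div, norm_pow, Complex.norm_real, div_eq_mul_inv]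
    have : z.im / 2 ≤ ‖(t : ℂ) - w‖ := hw.le.trans <| by
      simpa [abs_of_pos (him w hw)] using Complex.abs_im_le_norm ((t : ℂ) - w)
    gcongr
  have hmeas : ∀ w ∈ s, AEStronglyMeasurable (fun t : ℝ => (p t : ℂ) / (t - w)) volume :=
    fun w hw => (integrable_div_ofReal_sub hp (him w hw)).aestronglyMeasurable
  have hmeas' : AEStronglyMeasurable (fun t : ℝ => (p t : ℂ) / (t - z) ^ 2) volume :=
    (hp.ofReal.aemeasurable.div (by fun_prop)).aestronglyMeasurable
  exact ((hasDerivAt_integral_of_dominated_loc_of_deriv_le hs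
    (eventually_of_mem hs hmeas) (integrable_div_ofReal_sub hp hz) hmeas'
    (.of_forall hbound) (hp.norm.mul_const _) (.of_forall hderiv)).2.const_mul
      _).differentiableAt.differentiableWithinAt

theorem herglotz_re_nonneg (hp : Integrable p) (h0 : ∀ t, 0 ≤ p t) (hz : z ∈ upperHalf) :
    0 ≤ (herglotz p z).re := by
  rw [herglotz_re hp hz]
  exact integral_nonneg fun t => mul_nonneg (upperHalfPoisson_nonneg (le_of_lt hz) t) (h0 t)

theorem herglotz_re_le (hp : Integrable p) (h0 : ∀ t, 0 ≤ p t) (hz : z ∈ upperHalf) :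
    (herglotz p z).re ≤ (∫ t, p t) / (Real.pi * z.im) := by
  rw [herglotz_re hp hz, div_eq_inv_mul, ← integral_const_mul]
  refine integral_mono_of_nonneg (.of_forall fun t => ?_) (hp.const_mul _) (.of_forall fun t => ?_)
  · exact mul_nonneg (upperHalfPoisson_nonneg (le_of_lt hz) t) (h0 t)
  · exact mul_le_mul_of_nonneg_right (upperHalfPoisson_le hz t) (h0 t)

end Herglotz

theorem im_le_one_add_norm_sq (z : ℂ) : z.im ≤ (1 + ‖z‖) ^ 2 := by
  nlinarith [(le_abs_self _).trans (Complex.abs_im_le_norm z), norm_nonneg z]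

theorem hasNevanlinnaGrowth_of_norm_le {u : ℂ → ℂ} {C : ℝ}
    (h : ∀ z ∈ upperHalf, ‖u z‖ ≤ C * ((1 + ‖z‖) ^ 2 / z.im)) : HasNevanlinnaGrowth u := by
  refine ⟨|C|, abs_nonneg C, fun z hz => (h z hz).trans ?_⟩
  have hz' : 0 < z.im := hz
  calc C * ((1 + ‖z‖) ^ 2 / z.im) ≤ |C| * ((1 + ‖z‖) ^ 2 / z.im) := by gcongr; exact le_abs_self C
    _ ≤ Real.exp (|C| * ((1 + ‖z‖) ^ 2 / z.im)) := by
      linarith [Real.add_one_le_exp (|C| * ((1 + ‖z‖) ^ 2 / z.im))]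

theorem HasNevanlinnaGrowth.mul {u v : ℂ → ℂ} (hu : HasNevanlinnaGrowth u)
    (hv : HasNevanlinnaGrowth v) : HasNevanlinnaGrowth (fun z => u z * v z) := by
  obtain ⟨A, hA, hu⟩ := hu
  obtain ⟨B, hB, hv⟩ := hv
  refine ⟨A + B, add_nonneg hA hB, fun z hz => ?_⟩
  rw [norm_mul, add_mul, Real.exp_add]
  exact mul_le_mul (hu z hz) (hv z hz) (norm_nonneg _) (Real.exp_pos _).le

theorem meanType_mul_nonpos {u v : ℂ → ℂ} (hu : meanType u ≤ 0) (hv : meanType v ≤ 0) :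
    meanType (fun z => u z * v z) ≤ 0 := by
  rw [meanType_nonpos_iff] at hu hv ⊢
  intro ε hε
  filter_upwards [hu (ε / 2) (half_pos hε), hv (ε / 2) (half_pos hε)] with y hy hy'
  calc ‖u (y * Complex.I) * v (y * Complex.I)‖ ≤ Real.exp (ε / 2 * y) * Real.exp (ε / 2 * y) := by
        rw [norm_mul]; gcongr
    _ = Real.exp (ε * y) := by rw [← Real.exp_add]; ring_nf

/-- Boundary-regular functions of the Hardy space `H²` of the upper half-plane: continuous up to
the real line with square-integrable boundary values. The Nevanlinna growth condition, which
follows from bounded type and from an `H²` bound alike, stands in for both. -/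
structure IsHardy (u : ℂ → ℂ) : Prop where
  diffContOnCl : DiffContOnCl ℂ u upperHalf
  memLp : MemLp (fun t : ℝ => u t) 2
  hasNevanlinnaGrowth : HasNevanlinnaGrowth u
  meanType_nonpos : meanType u ≤ 0

namespace IsHardy

variable {u : ℂ → ℂ}

theorem of_norm_sq_le (hu : DiffContOnCl ℂ u upperHalf) (hL : MemLp (fun t : ℝ => u t) 2) {C : ℝ}
    (h : ∀ z ∈ upperHalf, ‖u z‖ ^ 2 ≤ C / z.im) : IsHardy u := by
  have hle : ∀ z, ‖u z‖ ≤ 1 + ‖u z‖ ^ 2 := fun z => by nlinarith [sq_nonneg (‖u z‖ - 1)]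
  refine ⟨hu, hL, hasNevanlinnaGrowth_of_norm_le (C := 1 + |C|) fun z hz => ?_,
    meanType_nonpos_of_bounded (C := 1 + |C|) ?_⟩
  · have hz' : 0 < z.im := hz
    rw [add_mul, one_mul, ← mul_div_assoc]
    refine (hle z).trans (add_le_add ?_ ((h z hz).trans ?_))
    · exact (one_le_div hz').2 (im_le_one_add_norm_sq z)
    · gcongr
      exact (le_abs_self C).trans (le_mul_of_one_le_right (abs_nonneg C)
        (one_le_pow₀ (le_add_of_nonneg_right (norm_nonneg z))))
  · filter_upwards [eventually_ge_atTop 1] with y hy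
    have hmem : (y * Complex.I : ℂ) ∈ upperHalf := by
      simpa [upperHalf] using one_pos.trans_le hy
    refine (hle _).trans (add_le_add_right ((h _ hmem).trans ?_) 1)
    rw [Complex.im_ofReal_mul, Complex.I_im, mul_one]
    exact (div_le_div_of_nonneg_right (le_abs_self C) (by positivity)).trans
      (div_le_self (abs_nonneg C) hy)

theorem continuousOn (hu : IsHardy u) : ContinuousOn u {z | 0 ≤ z.im} :=
  closure_upperHalf ▸ hu.diffContOnCl.continuousOn

theorem continuous_ofReal (hu : IsHardy u) : Continuous fun t : ℝ => u t :=
  hu.continuousOn.comp_continuous Complex.continuous_ofReal fun t => (Complex.ofReal_im t).ge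

theorem integrable_norm_sq (hu : IsHardy u) : Integrable fun t : ℝ => ‖u t‖ ^ 2 :=
  (memLp_two_iff_integrable_sq_norm hu.memLp.aestronglyMeasurable).1 hu.memLp

theorem eventually_norm_sq_div_herglotz_le (hu : IsHardy u) {ε : ℝ} (hε : 0 < ε) (b t : ℝ) {c : ℝ}
    (hc : 1 < c) : ∀ᶠ z in 𝓝[upperHalf] (t : ℂ),
      ‖u z * u z * (herglotz (fun t => ‖u t‖ ^ 2) z + ε - b * Complex.I)⁻¹‖ ≤ c := by
  have hcont : ContinuousWithinAt u upperHalf t :=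
    hu.diffContOnCl.continuousOn.continuousWithinAt (by simp [closure_upperHalf])
      |>.mono subset_closure
  have hnum : Tendsto (fun z => ‖u z‖ ^ 2) (𝓝[upperHalf] (t : ℂ)) (𝓝 (‖u t‖ ^ 2)) :=
    hcont.tendsto.norm.pow 2
  have hden := (tendsto_integral_upperHalfPoisson_mul hu.integrable_norm_sq
    (hu.continuous_ofReal.norm.pow 2).continuousAt (x := t)).add_const ε
  have hlt : ‖u t‖ ^ 2 < c * (‖u t‖ ^ 2 + ε) := by nlinarith [sq_nonneg ‖u t‖]
  filter_upwards [hnum.eventually_lt (hden.const_mul c) hlt, self_mem_nhdsWithin] with z hz hmem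
  rw [← herglotz_re hu.integrable_norm_sq hmem] at hz
  have := herglotz_re_nonneg hu.integrable_norm_sq (fun _ => sq_nonneg _) hmem
  rw [norm_mul, norm_mul, ← sq, norm_inv, ← div_eq_mul_inv]
  refine div_le_of_le_mul₀ (norm_nonneg _) (by positivity) (hz.le.trans ?_)
  gcongr
  simpa using Complex.re_le_norm (herglotz (fun t => ‖u t‖ ^ 2) z + ε - b * Complex.I)

/-- Phragmén–Lindelöf applied to `u ^ 2` divided by the Herglotz transform of `‖u‖ ^ 2`, whose real
part has boundary values `‖u‖ ^ 2`. -/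
theorem norm_sq_le_herglotz_re (hu : IsHardy u) {z : ℂ} (hz : z ∈ upperHalf) :
    ‖u z‖ ^ 2 ≤ (herglotz (fun t => ‖u t‖ ^ 2) z).re := by
  set H := herglotz fun t => ‖u t‖ ^ 2
  refine le_of_forall_pos_le_add fun ε hε => ?_
  set d : ℂ → ℂ := fun x => H x + ε - (H z).im * Complex.I
  have hle : ∀ x ∈ upperHalf, ε ≤ ‖d x‖ := fun x hx => by
    have h0 : 0 ≤ (H x).re := herglotz_re_nonneg hu.integrable_norm_sq (fun _ => sq_nonneg _) hx
    have := Complex.re_le_norm (d x)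
    simp [d] at this
    linarith
  have hne : ∀ x ∈ upperHalf, d x ≠ 0 := fun x hx => norm_pos_iff.1 (hε.trans_le (hle x hx))
  have hinv : ∀ x ∈ upperHalf, ‖(d x)⁻¹‖ ≤ ε⁻¹ := fun x hx => by
    rw [norm_inv]; exact inv_anti₀ hε (hle x hx)
  have hd : DifferentiableOn ℂ d upperHalf :=
    ((differentiableOn_herglotz hu.integrable_norm_sq).add_const _).sub_const _
  have hu' := hu.diffContOnCl.differentiableOn
  have hgrowth : HasNevanlinnaGrowth fun x => (d x)⁻¹ :=
    hasNevanlinnaGrowth_of_norm_le fun x hx => (hinv x hx).trans <| le_mul_of_one_le_right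
      (inv_pos.2 hε).le ((one_le_div hx).2 (im_le_one_add_norm_sq x))
  have hmean : meanType (fun x => (d x)⁻¹) ≤ 0 := meanType_nonpos_of_bounded <| by
    filter_upwards [eventually_gt_atTop 0] with y hy
    exact hinv _ (by simpa [upperHalf] using hy)
  have key := ((hu.hasNevanlinnaGrowth.mul hu.hasNevanlinnaGrowth).mul hgrowth).norm_le_one
    ((hu'.mul hu').mul (hd.inv hne))
    (fun t _ hc => hu.eventually_norm_sq_div_herglotz_le hε (H z).im t hc)
    (meanType_mul_nonpos (meanType_mul_nonpos hu.meanType_nonpos hu.meanType_nonpos) hmean) hz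
  have hdz : d z = ((H z).re + ε : ℝ) := by
    apply Complex.ext <;> simp [d]
  rw [norm_mul, norm_mul, ← sq, norm_inv, ← div_eq_mul_inv,
    div_le_one (norm_pos_iff.2 (hne z hz)), hdz, Complex.norm_real, Real.norm_of_nonneg] at key
  · exact key
  · exact add_nonneg (herglotz_re_nonneg hu.integrable_norm_sq (fun _ => sq_nonneg _) hz) hε.le

theorem norm_sq_le (hu : IsHardy u) {z : ℂ} (hz : z ∈ upperHalf) :
    ‖u z‖ ^ 2 ≤ (∫ t : ℝ, ‖u t‖ ^ 2) / (Real.pi * z.im) :=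
  (hu.norm_sq_le_herglotz_re hz).trans
    (herglotz_re_le hu.integrable_norm_sq (fun _ => sq_nonneg _) hz)

theorem isBoundedType (hu : IsHardy u) : IsBoundedType u := by
  set H := herglotz fun t => ‖u t‖ ^ 2
  have hle : ∀ z ∈ upperHalf, 1 + ‖u z‖ ^ 2 ≤ ‖1 + H z‖ := fun z hz => by
    have := Complex.re_le_norm (1 + H z)
    rw [Complex.add_re, Complex.one_re] at this
    linarith [hu.norm_sq_le_herglotz_re hz]
  have hpos : ∀ z ∈ upperHalf, 0 < ‖1 + H z‖ := fun z hz =>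
    (by positivity : (0 : ℝ) < 1 + ‖u z‖ ^ 2).trans_le (hle z hz)
  have hinv : DifferentiableOn ℂ (fun z => (1 + H z)⁻¹) upperHalf :=
    ((differentiableOn_herglotz hu.integrable_norm_sq).const_add 1).inv
      fun z hz => norm_pos_iff.1 (hpos z hz)
  refine ⟨fun z => u z * (1 + H z)⁻¹, fun z => (1 + H z)⁻¹,
    hu.diffContOnCl.differentiableOn.mul hinv, hinv, ⟨1, fun z hz => ?_⟩, ⟨1, fun z hz => ?_⟩,
    ⟨Complex.I, I_mem_upperHalf, inv_ne_zero (norm_pos_iff.1 (hpos _ I_mem_upperHalf))⟩,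
    fun z _ => rfl⟩
  · rw [norm_mul, norm_inv, ← div_eq_mul_inv, div_le_one (hpos z hz)]
    nlinarith [hle z hz, sq_nonneg (‖u z‖ - 1)]
  · rw [norm_inv]
    exact inv_le_one_of_one_le₀ ((le_add_of_nonneg_right (sq_nonneg _)).trans (hle z hz))

end IsHardy

theorem intervalIntegral_inv_sqrt {R : ℝ} (hR : 0 ≤ R) :
    IntervalIntegrable (fun y => (√y)⁻¹) volume 0 R ∧ ∫ y in 0..R, (√y)⁻¹ = 2 * √R := by
  have h : Set.EqOn (fun y : ℝ => (√y)⁻¹) (fun y => y ^ (-(1 / 2) : ℝ)) (Set.uIcc 0 R) :=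
    fun y hy => by
    rw [Set.uIcc_of_le hR] at hy
    simp only [Real.rpow_neg hy.1, Real.sqrt_eq_rpow]
  refine ⟨(intervalIntegrable_congr (h.mono Set.uIoc_subset_uIcc)).2
    (intervalIntegral.intervalIntegrable_rpow' (by norm_num)), ?_⟩
  rw [intervalIntegral.integral_congr h, integral_rpow (.inl (by norm_num)), Real.sqrt_eq_rpow]
  norm_num [Real.zero_rpow]
  ring

section Decay

variable {g : ℂ → ℂ} {C R : ℝ}

theorem norm_integral_vertical_le
    (hdecay : ∀ z ∈ upperHalf, R ≤ ‖z‖ → ‖g z‖ ≤ C / (√z.im * ‖z‖)) (hC : 0 ≤ C) (hR : 0 < R)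
    {x : ℝ} (hx : |x| = R) :
    ‖∫ y in (0 : ℝ)..R, g (x + y * Complex.I)‖ ≤ 2 * C / √R := by
  have hbound : ∀ y ∈ Set.Ioc 0 R, ‖g (x + y * Complex.I)‖ ≤ C / R * (√y)⁻¹ := fun y hy => by
    have him : (x + y * Complex.I : ℂ).im = y := by simp
    have hnorm : R ≤ ‖(x + y * Complex.I : ℂ)‖ := by
      simpa [hx] using Complex.abs_re_le_norm (x + y * Complex.I)
    have hy0 : 0 < √y := Real.sqrt_pos.2 hy.1
    refine (hdecay _ (by simpa [upperHalf] using hy.1) hnorm).trans ?_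
    rw [him, div_mul_eq_div_div, div_right_comm, ← div_eq_mul_inv]
    gcongr
  obtain ⟨hint, hval⟩ := intervalIntegral_inv_sqrt hR.le
  refine (intervalIntegral.norm_integral_le_of_norm_le hR.le (.of_forall hbound)
    (hint.const_mul _)).trans_eq ?_
  rw [intervalIntegral.integral_const_mul, hval]
  nth_rw 1 [← Real.mul_self_sqrt hR.le]
  field_simp

theorem norm_integral_horizontal_le
    (hdecay : ∀ z ∈ upperHalf, R ≤ ‖z‖ → ‖g z‖ ≤ C / (√z.im * ‖z‖)) (hC : 0 ≤ C) (hR : 0 < R) :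
    ‖∫ x in -R..R, g (x + R * Complex.I)‖ ≤ 2 * C / √R := by
  have hbound : ∀ x : ℝ, ‖g (x + R * Complex.I)‖ ≤ C / (√R * R) := fun x => by
    have him : (x + R * Complex.I : ℂ).im = R := by simp
    have hnorm : R ≤ ‖(x + R * Complex.I : ℂ)‖ := by
      simpa [abs_of_pos hR] using Complex.abs_im_le_norm (x + R * Complex.I)
    refine (hdecay _ (by simpa [upperHalf] using hR) hnorm).trans ?_
    rw [him]
    gcongr
  refine (intervalIntegral.norm_integral_le_of_norm_le_const fun x _ => hbound x).trans_eq ?_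
  rw [sub_neg_eq_add, abs_of_pos (by positivity)]
  field_simp
  ring

theorem norm_intervalIntegral_le (hg : DiffContOnCl ℂ g upperHalf)
    (hdecay : ∀ z ∈ upperHalf, R ≤ ‖z‖ → ‖g z‖ ≤ C / (√z.im * ‖z‖)) (hC : 0 ≤ C) (hR : 0 < R) :
    ‖∫ x in -R..R, g x‖ ≤ 6 * C / √R := by
  have hcont : ContinuousOn g (Set.uIcc (-R) R ×ℂ Set.uIcc 0 R) :=
    hg.continuousOn.mono fun z hz => by
      rw [closure_upperHalf]
      exact (Set.uIcc_of_le hR.le ▸ hz.2).1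
  have hdiff : DifferentiableOn ℂ g (Set.Ioo (-R) R ×ℂ Set.Ioo 0 R) :=
    hg.differentiableOn.mono fun z hz => hz.2.1
  have hrect := Complex.integral_boundary_rect_eq_zero_of_continuousOn_of_differentiableOn g
    (-R : ℝ) (R + R * Complex.I) (by simpa using hcont)
    (by simpa [hR.le, (neg_lt_self hR).le] using hdiff)
  simp only [Complex.ofReal_re, Complex.ofReal_im, Complex.add_re, Complex.add_im,
    Complex.re_ofReal_mul, Complex.im_ofReal_mul, Complex.I_re, Complex.I_im, mul_zero, mul_one,
    add_zero, zero_add, Complex.ofReal_zero, zero_mul, smul_eq_mul] at hrect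
  have hsum : ∫ x in -R..R, g x = (∫ x in -R..R, g (x + R * Complex.I)) -
      Complex.I * (∫ y in (0 : ℝ)..R, g (R + y * Complex.I)) +
      Complex.I * ∫ y in (0 : ℝ)..R, g ((-R : ℝ) + y * Complex.I) := by
    linear_combination hrect
  have htop := norm_integral_horizontal_le hdecay hC hR
  have hright := norm_integral_vertical_le hdecay hC hR (abs_of_pos hR)
  have hleft := norm_integral_vertical_le hdecay hC hR ((abs_neg R).trans (abs_of_pos hR))
  have hI : ∀ c : ℂ, ‖Complex.I * c‖ = ‖c‖ := fun c => by rw [norm_mul, Complex.norm_I, one_mul]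
  rw [hsum]
  refine (norm_add_le_of_le (norm_sub_le_of_le htop ((hI _).trans_le hright))
    ((hI _).trans_le hleft)).trans_eq ?_
  ring

end Decay

theorem integral_ofReal_eq_zero_of_norm_le {g : ℂ → ℂ} (hg : DiffContOnCl ℂ g upperHalf)
    (hint : Integrable fun t : ℝ => g t) {C r : ℝ} (hC : 0 ≤ C)
    (hdecay : ∀ z ∈ upperHalf, r ≤ ‖z‖ → ‖g z‖ ≤ C / (√z.im * ‖z‖)) : ∫ t : ℝ, g t = 0 := by
  have hlim : Tendsto (fun R : ℝ => 6 * C / √R) atTop (𝓝 0) :=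
    tendsto_const_nhds.div_atTop Real.tendsto_sqrt_atTop
  refine tendsto_nhds_unique
    (intervalIntegral_tendsto_integral hint tendsto_neg_atTop_atBot tendsto_id)
    (squeeze_zero_norm' ?_ hlim)
  filter_upwards [eventually_gt_atTop (max r 0)] with R hR
  exact norm_intervalIntegral_le hg (fun z hz h => hdecay z hz
    (((le_max_left r 0).trans hR.le).trans h)) hC ((le_max_right r 0).trans_lt hR)

theorem memLp_inv_sub {a : ℂ} (ha : a.im ≠ 0) : MemLp (fun t : ℝ => ((t : ℂ) - a)⁻¹) 2 := by
  have hc : Continuous fun t : ℝ => ((t : ℂ) - a)⁻¹ :=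
    Continuous.inv₀ (by fun_prop) (ofReal_sub_ne_zero ha)
  refine (memLp_two_iff_integrable_sq_norm hc.aestronglyMeasurable).2 ?_
  refine ((integrable_upperHalfPoisson ha).const_mul (Real.pi / a.im)).congr
    (.of_forall fun t => ?_)
  simp only [upperHalfPoisson, norm_inv]
  field_simp

theorem integrable_div_sub {u : ℝ → ℂ} (hu : MemLp u 2) {a : ℂ} (ha : a.im ≠ 0) :
    Integrable fun t => u t / (t - a) :=
  hu.integrable_mul (memLp_inv_sub ha)

theorem sq_im_add_im_le_norm_sub_conj_sq (w z : ℂ) : (w.im + z.im) ^ 2 ≤ ‖z - conj w‖ ^ 2 := by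
  rw [← Complex.normSq_eq_norm_sq, Complex.normSq_apply]
  simp only [Complex.sub_im, Complex.conj_im]
  nlinarith [sq_nonneg (z - conj w).re]

theorem isHardy_inv_sub_conj {w : ℂ} (hw : w ∈ upperHalf) : IsHardy fun z => (z - conj w)⁻¹ := by
  have hw' : 0 < w.im := hw
  have hne : ∀ z ∈ closure upperHalf, z - conj w ≠ 0 := fun z hz h => by
    rw [closure_upperHalf] at hz
    have := congrArg Complex.im h
    simp at this
    linarith [show 0 ≤ z.im from hz]
  have hd : DiffContOnCl ℂ (fun z => z - conj w) upperHalf :=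
    (differentiable_id.sub_const _).diffContOnCl
  refine .of_norm_sq_le (hd.inv hne) (memLp_inv_sub (by simpa using hw'.ne'))
    (C := (4 * w.im)⁻¹) fun z hz => ?_
  have hz' : 0 < z.im := hz
  rw [norm_inv, inv_pow, div_eq_mul_inv, ← mul_inv]
  refine inv_anti₀ (by positivity) (le_trans ?_ (sq_im_add_im_le_norm_sub_conj_sq w z))
  linarith [sq_nonneg (w.im - z.im)]

namespace IsHardy

variable {u v : ℂ → ℂ}

theorem sub_const_mul (hu : IsHardy u) (hv : IsHardy v) (c : ℂ) :
    IsHardy fun z => u z - c * v z := by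
  refine .of_norm_sq_le (hu.diffContOnCl.sub (hv.diffContOnCl.const_smul c))
    (hu.memLp.sub (hv.memLp.const_mul c))
    (C := 2 * (∫ t : ℝ, ‖u t‖ ^ 2) / Real.pi + 2 * ‖c‖ ^ 2 * (∫ t : ℝ, ‖v t‖ ^ 2) / Real.pi)
    fun z hz => ?_
  have hsub : ‖u z - c * v z‖ ^ 2 ≤ 2 * ‖u z‖ ^ 2 + 2 * ‖c‖ ^ 2 * ‖v z‖ ^ 2 := by
    have := pow_le_pow_left₀ (norm_nonneg _) (norm_sub_le (u z) (c * v z)) 2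
    rw [norm_mul] at this
    nlinarith [sq_nonneg (‖u z‖ - ‖c‖ * ‖v z‖)]
  calc ‖u z - c * v z‖ ^ 2 ≤ 2 * ((∫ t : ℝ, ‖u t‖ ^ 2) / (Real.pi * z.im)) +
        2 * ‖c‖ ^ 2 * ((∫ t : ℝ, ‖v t‖ ^ 2) / (Real.pi * z.im)) := by
        refine hsub.trans ?_
        gcongr
        exacts [hu.norm_sq_le hz, hv.norm_sq_le hz]
    _ = _ := by
        have hz' : z.im ≠ 0 := ne_of_gt hz
        field_simp

theorem norm_le_div_sqrt (hu : IsHardy u) {z : ℂ} (hz : z ∈ upperHalf) :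
    ‖u z‖ ≤ √((∫ t : ℝ, ‖u t‖ ^ 2) / Real.pi) / √z.im := by
  rw [← Real.sqrt_div' _ (le_of_lt hz), div_div]
  exact Real.le_sqrt_of_sq_le (hu.norm_sq_le hz)

theorem integral_div_sub_eq_zero (hu : IsHardy u) {a : ℂ} (ha : a.im ≠ 0) {g : ℂ → ℂ}
    (hg : DiffContOnCl ℂ g upperHalf) (h : ∀ z, z ≠ a → g z = u z / (z - a)) :
    ∫ t : ℝ, u t / (t - a) = 0 := by
  have hgt : ∀ t : ℝ, g t = u t / (t - a) := fun t => h t (sub_ne_zero.1 (ofReal_sub_ne_zero ha t))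
  simp_rw [← hgt]
  refine integral_ofReal_eq_zero_of_norm_le hg
    ((integrable_div_sub hu.memLp ha).congr (.of_forall fun t => (hgt t).symm))
    (C := √((∫ t : ℝ, ‖u t‖ ^ 2) / Real.pi) * 2) (r := 2 * ‖a‖) (by positivity) fun z hz hza => ?_
  have ha0 : 0 < ‖a‖ := norm_pos_iff.2 fun h => ha (by rw [h, Complex.zero_im])
  have hfar : ‖z‖ / 2 ≤ ‖z - a‖ := by linarith [norm_sub_norm_le z a]
  have hz0 : 0 < ‖z‖ := by linarith
  have hz' : 0 < z.im := hz
  rw [h z (sub_ne_zero.1 (norm_pos_iff.1 (by linarith))), norm_div]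
  refine (div_le_div₀ (by positivity) (hu.norm_le_div_sqrt hz) (by positivity) hfar).trans_eq ?_
  field_simp

theorem integral_div_sub_conj (hu : IsHardy u) {w : ℂ} (hw : w ∈ upperHalf) :
    ∫ t : ℝ, u t / (t - conj w) = 0 :=
  hu.integral_div_sub_eq_zero (by simpa using (ne_of_gt hw : w.im ≠ 0))
    (hu.diffContOnCl.smul (isHardy_inv_sub_conj hw).diffContOnCl) fun _ _ => rfl

theorem integral_div_sub_of_eq_zero (hu : IsHardy u) {w : ℂ} (hw : w ∈ upperHalf) (h0 : u w = 0) :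
    ∫ t : ℝ, u t / (t - w) = 0 := by
  have hnhds : upperHalf ∈ 𝓝 w := isOpen_upperHalf.mem_nhds hw
  have hd := hu.diffContOnCl.differentiableOn
  refine hu.integral_div_sub_eq_zero (ne_of_gt hw) (g := dslope u w)
    ⟨(Complex.differentiableOn_dslope hnhds).2 hd, ?_⟩ fun z hz => ?_
  · exact (continuousOn_dslope (mem_of_superset hnhds subset_closure)).2
      ⟨hu.diffContOnCl.continuousOn, hd.differentiableAt hnhds⟩
  · rw [dslope_of_ne _ hz, slope_def_field, h0, sub_zero]

theorem integral_div_sub (hu : IsHardy u) {w : ℂ} (hw : w ∈ upperHalf) :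
    ∫ t : ℝ, u t / (t - w) = 2 * Real.pi * Complex.I * u w := by
  have hw' : w.im ≠ 0 := ne_of_gt hw
  have hww : w - conj w ≠ 0 := sub_conj_ne_zero hw hw
  set c : ℂ := u w * (w - conj w)
  have hv := isHardy_inv_sub_conj hw
  have hzero := (hu.sub_const_mul hv c).integral_div_sub_of_eq_zero hw (by
    simp [c, mul_assoc, mul_inv_cancel₀ hww])
  have hpoisson : ∀ t : ℝ, ((t : ℂ) - conj w)⁻¹ / (t - w) =
      (Real.pi / w.im : ℝ) * (upperHalfPoisson w t : ℂ) := fun t => by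
    have hnorm : ((‖(t : ℂ) - w‖ ^ 2 : ℝ) : ℂ) = (t - conj w) * (t - w) := by
      rw [Complex.ofReal_pow, ← Complex.conj_mul', map_sub, Complex.conj_ofReal]
    rw [← Complex.ofReal_mul, upperHalfPoisson, show Real.pi / w.im * (Real.pi⁻¹ *
      (w.im / ‖(t : ℂ) - w‖ ^ 2)) = (‖(t : ℂ) - w‖ ^ 2)⁻¹ by field_simp, Complex.ofReal_inv, hnorm,
      mul_inv, div_eq_mul_inv]
  have hsplit : ∀ t : ℝ, (u t - c * ((t : ℂ) - conj w)⁻¹) / (t - w) =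
      u t / (t - w) - c * (((t : ℂ) - conj w)⁻¹ / (t - w)) := fun t => by ring
  simp_rw [hsplit] at hzero
  rw [integral_sub (integrable_div_sub hu.memLp hw')
    ((integrable_div_sub hv.memLp hw').const_mul c), integral_const_mul, sub_eq_zero] at hzero
  rw [hzero]
  simp_rw [hpoisson]
  rw [integral_const_mul, integral_complex_ofReal, integral_upperHalfPoisson hw,
    Complex.ofReal_one, mul_one, Complex.ofReal_div]
  simp only [c, Complex.sub_conj]
  push_cast
  field_simp [Complex.ofReal_ne_zero.2 hw']

end IsHardy

/-! ### The de Branges space as a reproducing kernel Hilbert space -/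

namespace HermiteBiehler

variable {E : HermiteBiehler}

theorem ne_zero_of_mem_closure_upperHalf (hE : ∀ x : ℝ, E x ≠ 0) {z : ℂ}
    (hz : z ∈ closure upperHalf) : E z ≠ 0 := by
  rw [closure_upperHalf] at hz
  rcases (show 0 ≤ z.im from hz).eq_or_lt with him | him
  · have hre : (z.re : ℂ) = z := Complex.ext rfl him
    exact hre ▸ hE z.re
  · exact E.ne_zero him

theorem starFun_ofReal (f : ℂ → ℂ) (t : ℝ) : starFun f t = conj (f t) := by
  rw [starFun, Complex.conj_ofReal]

theorem norm_starFun_ofReal_div (f : ℂ → ℂ) (t : ℝ) : ‖starFun f t / E t‖ = ‖f t / E t‖ := by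
  rw [starFun_ofReal, norm_div, norm_div, RCLike.norm_conj]

theorem memLp_starFun_div {f : ℂ → ℂ} (hf : Differentiable ℂ f)
    (h : MemLp (fun t : ℝ => f t / E t) 2) : MemLp (fun t : ℝ => starFun f t / E t) 2 :=
  h.congr_norm (E.measurable_div hf.starFun.continuous).aestronglyMeasurable
    (.of_forall fun t => (norm_starFun_ofReal_div f t).symm)

theorem diffContOnCl_div (hE : ∀ x : ℝ, E x ≠ 0) {f : ℂ → ℂ} (hf : Differentiable ℂ f) :
    DiffContOnCl ℂ (fun z => f z / E z) upperHalf :=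
  hf.diffContOnCl.smul
    (E.differentiable.diffContOnCl.inv fun _ => ne_zero_of_mem_closure_upperHalf hE)

theorem conj_kernelFun (E : HermiteBiehler) (w z : ℂ) :
    conj (E.kernelFun w z) = E.kernelFun z w := by
  by_cases h : z = conj w
  · have hstar := congrFun (E.starFun_kernelFun w) w
    rwa [starFun, ← h] at hstar
  · have hconj := congrArg conj (E.kernelFun_mul w z)
    have hne : conj z - w ≠ 0 := fun hzw => h (by rw [← sub_eq_zero.1 hzw, Complex.conj_conj])
    have hden : (2 * Real.pi * Complex.I * (conj z - w) : ℂ) ≠ 0 :=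
      mul_ne_zero Complex.two_pi_I_ne_zero hne
    refine mul_right_cancel₀ hden ?_
    rw [kernelFun_mul]
    simp only [kernelNum, starFun, map_mul, map_sub, Complex.conj_conj, Complex.conj_I,
      Complex.conj_ofReal, Complex.conj_ofNat] at hconj ⊢
    linear_combination hconj

theorem dense_setOf_im_ne_zero : Dense {z : ℂ | z.im ≠ 0} :=
  (dense_compl_singleton (0 : ℝ)).preimage Complex.isOpenMap_im

namespace Space

theorem isHardy_div (hE : ∀ x : ℝ, E x ≠ 0) (f : E.Space) : IsHardy fun z => f z / E z where
  diffContOnCl := diffContOnCl_div hE f.2.1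
  memLp := f.2.2.1
  hasNevanlinnaGrowth := f.2.2.2.1.hasNevanlinnaGrowth (diffContOnCl_div hE f.2.1).differentiableOn
  meanType_nonpos := f.2.2.2.2.1

/-- The conjugation `f ↦ f*` of the de Branges space, which exchanges the half-planes. -/
def conjStar (f : E.Space) : E.Space :=
  ⟨starFun f, f.2.1.starFun, memLp_starFun_div f.2.1 f.2.2.1, f.2.2.2.2.2.1, f.2.2.2.2.2.2, by
    rw [starFun_starFun]; exact f.2.2.2.1, by rw [starFun_starFun]; exact f.2.2.2.2.1⟩

theorem conjStar_apply (f : E.Space) (z : ℂ) : f.conjStar z = conj (f (conj z)) := rfl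

theorem conjStar_ofReal (f : E.Space) (t : ℝ) : f.conjStar t = conj (f t) := starFun_ofReal _ t

theorem inner_conjStar (f g : E.Space) : inner ℂ f.conjStar g.conjStar = conj (inner ℂ f g) := by
  rw [inner_eq, inner_eq, ← integral_conj]
  congr 1
  funext t
  simp [conjStar_ofReal]

theorem conjStar_kernel (w : ℂ) : (E.kernel w).conjStar = E.kernel (conj w) :=
  ext fun z => congrFun (E.starFun_kernelFun w) z

theorem kernel_apply (w z : ℂ) : E.kernel w z = E.kernelFun w z := rfl

theorem mul_conj_kernel_div (hE : ∀ x : ℝ, E x ≠ 0) (f : E.Space) {w : ℂ} (hw : w.im ≠ 0)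
    (t : ℝ) :
    f t * conj (E.kernel w t) / (‖E t‖ : ℂ) ^ 2 = (2 * Real.pi * Complex.I)⁻¹ *
      (E w * (f t / E t / (t - w)) -
        conj (E (conj w)) * conj (f.conjStar t / E t / (t - conj w))) := by
  have hk := congrArg conj (E.kernelFun_mul w t)
  simp only [kernelNum, starFun_ofReal, map_mul, map_sub, Complex.conj_conj, Complex.conj_I,
    Complex.conj_ofReal, Complex.conj_ofNat] at hk
  have hne := ofReal_sub_ne_zero hw t
  have hpi : (Real.pi : ℂ) ≠ 0 := Complex.ofReal_ne_zero.2 Real.pi_ne_zero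
  have hconj : conj (E.kernel w t) = (E w * conj (E t) - conj (E (conj w)) * E t) /
      (2 * Real.pi * Complex.I * (t - w)) := by
    rw [kernel_apply, eq_div_iff (by simp [hpi, hne]), ← hk]
    ring
  have hEt := hE t
  have hEt' : conj (E t) ≠ 0 := (map_ne_zero _).2 hEt
  rw [hconj, ← Complex.mul_conj', conjStar_ofReal]
  simp only [map_div₀, map_sub, Complex.conj_conj, Complex.conj_ofReal]
  field_simp

theorem inner_kernel_of_mem_upperHalf (hE : ∀ x : ℝ, E x ≠ 0) (f : E.Space) {w : ℂ}
    (hw : w ∈ upperHalf) : inner ℂ (E.kernel w) f = f w := by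
  have hw' : w.im ≠ 0 := ne_of_gt hw
  have hcauchy := (isHardy_div hE f).integral_div_sub hw
  have hzero : ∫ t : ℝ, conj (f.conjStar t / E t / (t - conj w)) = 0 := by
    rw [integral_conj, (isHardy_div hE f.conjStar).integral_div_sub_conj hw, map_zero]
  have hint : Integrable fun t : ℝ => conj (f.conjStar t / E t / (t - conj w)) :=
    Complex.conjCLE.toContinuousLinearMap.integrable_comp
      (integrable_div_sub f.conjStar.2.2.1 (by simpa using hw'))
  rw [inner_eq]
  simp_rw [mul_conj_kernel_div hE f hw']
  rw [integral_const_mul, integral_sub ((integrable_div_sub f.2.2.1 hw').const_mul _)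
    (hint.const_mul _), integral_const_mul, integral_const_mul, hcauchy, hzero]
  have hpi : (Real.pi : ℂ) ≠ 0 := Complex.ofReal_ne_zero.2 Real.pi_ne_zero
  have hEw := E.ne_zero hw
  field_simp
  ring

theorem inner_kernel_of_im_ne_zero (hE : ∀ x : ℝ, E x ≠ 0) (f : E.Space) {w : ℂ}
    (hw : w.im ≠ 0) : inner ℂ (E.kernel w) f = f w := by
  rcases hw.lt_or_gt with him | him
  · have h := inner_kernel_of_mem_upperHalf hE f.conjStar (w := conj w)
      (show 0 < (conj w).im by simpa)
    rw [← conjStar_kernel, inner_conjStar, conjStar_apply, Complex.conj_conj] at h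
    exact (starRingEnd ℂ).injective h
  · exact inner_kernel_of_mem_upperHalf hE f him

end Space

theorem norm_kernelNum_eq (w z : ℂ) :
    ‖E.kernelNum w z‖ = ‖E.kernelFun w z‖ * (2 * Real.pi * ‖conj w - z‖) := by
  rw [← kernelFun_mul]
  simp [abs_of_pos Real.pi_pos]

theorem exists_norm_kernelFun_self_le (E : HermiteBiehler) (w₀ : ℂ) :
    ∃ M, ∀ w ∈ Metric.ball w₀ 1, ‖E.kernelFun w w‖ ≤ M := by
  set r := 2 + dist w₀ (conj w₀)
  have hr : 2 ≤ r := le_add_of_nonneg_right dist_nonneg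
  have hcont : Continuous fun p : ℂ × ℂ => E.kernelNum p.1 p.2 := by
    have hE := E.differentiable.continuous
    have hstar := E.differentiable.starFun.continuous
    have := Complex.continuous_conj
    unfold kernelNum
    fun_prop
  obtain ⟨M, hM⟩ := ((isCompact_closedBall w₀ 1).prod
    (isCompact_closedBall (conj w₀) r)).exists_bound_of_continuousOn hcont.continuousOn
  refine ⟨M, fun w hw => ?_⟩
  have hconj : dist (conj w) (conj w₀) < 1 := by
    rwa [Complex.dist_conj_conj]
  refine Complex.norm_le_of_forall_mem_frontier_norm_le Metric.isBounded_ball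
    (U := Metric.ball (conj w₀) r) (E.differentiable_kernelFun w).diffContOnCl (fun z hz => ?_)
    (subset_closure ?_)
  · rw [frontier_ball _ (by linarith)] at hz
    refine le_trans ?_ (hM (w, z) ⟨Metric.ball_subset_closedBall hw,
      Metric.sphere_subset_closedBall hz⟩)
    have hfar : 1 ≤ ‖conj w - z‖ := by
      rw [← dist_eq_norm, dist_comm]
      linarith [dist_triangle z (conj w) (conj w₀), Metric.mem_sphere.1 hz]
    rw [norm_kernelNum_eq]
    exact le_mul_of_one_le_right (norm_nonneg _) (by nlinarith [Real.pi_gt_three])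
  · rw [Metric.mem_ball] at hw ⊢
    linarith [dist_triangle w w₀ (conj w₀)]

namespace Space

theorem exists_norm_apply_le (hE : ∀ x : ℝ, E x ≠ 0) (w₀ : ℂ) :
    ∃ M, 0 ≤ M ∧ ∀ w ∈ Metric.ball w₀ 1, ∀ f : E.Space, ‖f w‖ ≤ M * ‖f‖ := by
  obtain ⟨M, hM⟩ := E.exists_norm_kernelFun_self_le w₀
  refine ⟨√M, Real.sqrt_nonneg M, fun w hw f => ?_⟩
  have hclosed : IsClosed {z | ‖f z‖ ≤ √M * ‖f‖} :=
    isClosed_le f.2.1.continuous.norm continuous_const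
  refine closure_minimal ?_ hclosed
    (dense_setOf_im_ne_zero.open_subset_closure_inter Metric.isOpen_ball hw)
  rintro z ⟨hz, him⟩
  have hkernel : ‖E.kernel z‖ ≤ √M := by
    refine Real.le_sqrt_of_sq_le ?_
    rw [← inner_self_eq_norm_sq (𝕜 := ℂ), inner_kernel_of_im_ne_zero hE _ him]
    exact (Complex.re_le_norm _).trans (hM z hz)
  change ‖f z‖ ≤ _
  rw [← inner_kernel_of_im_ne_zero hE f him]
  exact (norm_inner_le_norm _ _).trans (by gcongr)

theorem sub_apply (f g : E.Space) (z : ℂ) : (f - g) z = f z - g z := rfl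

theorem norm_sq_eq (f : E.Space) : ‖f‖ ^ 2 = ∫ t : ℝ, ‖f t / E t‖ ^ 2 := by
  rw [← inner_self_eq_norm_sq (𝕜 := ℂ), inner_self]
  rfl

theorem norm_conjStar (f : E.Space) : ‖f.conjStar‖ = ‖f‖ := by
  rw [← sq_eq_sq₀ (norm_nonneg _) (norm_nonneg _), norm_sq_eq, norm_sq_eq]
  exact integral_congr_ae (.of_forall fun t => congrArg (· ^ 2) (norm_starFun_ofReal_div f t))

theorem eLpNorm_div (f : E.Space) :
    eLpNorm (fun t : ℝ => f t / E t) 2 = ENNReal.ofReal ‖f‖ := by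
  rw [f.2.2.1.eLpNorm_eq_integral_rpow_norm two_ne_zero ENNReal.ofNat_ne_top,
    ← Real.sqrt_sq (norm_nonneg f), norm_sq_eq, Real.sqrt_eq_rpow]
  norm_num

theorem eLpNorm_div_sub_div (f g : E.Space) :
    eLpNorm ((fun t : ℝ => f t / E t) - fun t : ℝ => g t / E t) 2 = ENNReal.ofReal ‖f - g‖ := by
  rw [← eLpNorm_div]
  congr 1
  funext t
  exact (sub_div _ _ _).symm

/-- Evaluation at `w`, as a continuous linear functional on the de Branges space. -/
noncomputable def evalCLM (hE : ∀ x : ℝ, E x ≠ 0) (w : ℂ) : E.Space →L[ℂ] ℂ :=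
  LinearMap.mkContinuousOfExistsBound ⟨⟨fun f => f w, fun _ _ => rfl⟩, fun _ _ => rfl⟩
    (let ⟨M, _, hM⟩ := exists_norm_apply_le hE w
    ⟨M, hM w (Metric.mem_ball_self one_pos)⟩)

theorem evalCLM_apply (hE : ∀ x : ℝ, E x ≠ 0) (w : ℂ) (f : E.Space) : evalCLM hE w f = f w := rfl

theorem exists_differentiable_tendsto (hE : ∀ x : ℝ, E x ≠ 0) {u : ℕ → E.Space}
    (hu : CauchySeq u) :
    ∃ g : ℂ → ℂ, Differentiable ℂ g ∧ ∀ z, Tendsto (fun n => u n z) atTop (𝓝 (g z)) := by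
  have hpointwise : ∀ z, ∃ a, Tendsto (fun n => u n z) atTop (𝓝 a) := fun z =>
    cauchySeq_tendsto_of_complete ((evalCLM hE z).uniformContinuous.comp_cauchySeq hu)
  choose g hg using hpointwise
  refine ⟨g, differentiableOn_univ.1 (TendstoLocallyUniformlyOn.differentiableOn
    (F := fun n z => u n z) (φ := atTop)
    (tendstoLocallyUniformlyOn_of_forall_exists_nhds fun w₀ _ => ?_)
    (.of_forall fun n => (u n).2.1.differentiableOn) isOpen_univ), hg⟩
  obtain ⟨M, hM0, hM⟩ := exists_norm_apply_le hE w₀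
  refine ⟨Metric.ball w₀ 1, mem_nhdsWithin_of_mem_nhds (Metric.ball_mem_nhds _ one_pos),
    UniformCauchySeqOn.tendstoUniformlyOn_of_tendsto
      (Metric.uniformCauchySeqOn_iff.2 fun ε hε => ?_) fun z _ => hg z⟩
  obtain ⟨N, hN⟩ := Metric.cauchySeq_iff.1 hu (ε / (M + 1)) (by positivity)
  refine ⟨N, fun m hm n hn z hz => ?_⟩
  have hlt := hN m hm n hn
  rw [dist_eq_norm, lt_div_iff₀ (by positivity)] at hlt
  rw [dist_eq_norm, ← sub_apply]
  linarith [hM z hz (u m - u n), norm_nonneg (u m - u n)]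

theorem isHardy_div_of_tendsto (hE : ∀ x : ℝ, E x ≠ 0) {u : ℕ → E.Space} {C : ℝ}
    (hC : ∀ n, ‖u n‖ ≤ C) {g : ℂ → ℂ} (hg : Differentiable ℂ g)
    (hL : MemLp (fun t : ℝ => g t / E t) 2)
    (hlim : ∀ z, Tendsto (fun n => u n z) atTop (𝓝 (g z))) : IsHardy fun z => g z / E z := by
  refine .of_norm_sq_le (diffContOnCl_div hE hg) hL (C := C ^ 2 / Real.pi) fun z hz =>
    le_of_tendsto' (((hlim z).div_const (E z)).norm.pow 2) fun n => ?_
  have hz' : 0 < z.im := hz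
  refine ((isHardy_div hE (u n)).norm_sq_le hz).trans ?_
  rw [← norm_sq_eq, ← div_div]
  gcongr
  exact hC n

theorem mem_deBrangesSubmodule_of_tendsto (hE : ∀ x : ℝ, E x ≠ 0) {u : ℕ → E.Space} {C : ℝ}
    (hC : ∀ n, ‖u n‖ ≤ C) {g : ℂ → ℂ} (hg : Differentiable ℂ g)
    (hL : MemLp (fun t : ℝ => g t / E t) 2)
    (hlim : ∀ z, Tendsto (fun n => u n z) atTop (𝓝 (g z))) : g ∈ E.deBrangesSubmodule := by
  have hH := isHardy_div_of_tendsto hE hC hg hL hlim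
  have hHstar := isHardy_div_of_tendsto hE (u := fun n => (u n).conjStar)
    (fun n => (norm_conjStar (u n)).trans_le (hC n)) hg.starFun (memLp_starFun_div hg hL)
    fun z => (Complex.continuous_conj.tendsto _).comp (hlim (conj z))
  exact ⟨hg, hL, hH.isBoundedType, hH.meanType_nonpos, hHstar.isBoundedType,
    hHstar.meanType_nonpos⟩

theorem completeSpace (hE : ∀ x : ℝ, E x ≠ 0) : CompleteSpace E.Space := by
  refine Metric.complete_of_convergent_controlled_sequences (fun n => (1 / 2) ^ n)
    (fun n => by positivity) fun u hu => ?_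
  have hcauchy : CauchySeq u := cauchySeq_of_le_tendsto_0 _ (fun n m N hn hm => (hu N n m hn hm).le)
    (tendsto_pow_atTop_nhds_zero_of_lt_one (by norm_num) (by norm_num))
  obtain ⟨g, hg, hlim⟩ := exists_differentiable_tendsto hE hcauchy
  have hmeas : AEStronglyMeasurable (fun t : ℝ => g t / E t) :=
    (E.measurable_div hg.continuous).aestronglyMeasurable
  have hconv : Tendsto (fun n => eLpNorm ((fun t : ℝ => u n t / E t) - fun t : ℝ => g t / E t) 2)
      atTop (𝓝 0) := by
    refine Lp.cauchy_tendsto_of_tendsto (B := fun n => ENNReal.ofReal ((1 / 2) ^ n))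
      (fun n => (u n).2.2.1.aestronglyMeasurable) _
      summable_geometric_two.tsum_ofReal_ne_top (fun N n m hn hm => ?_)
      (.of_forall fun t => (hlim t).div_const _)
    rw [eLpNorm_div_sub_div, ← dist_eq_norm]
    exact (ENNReal.ofReal_lt_ofReal_iff (by positivity)).2 (hu N n m hn hm)
  have hL := Lp.memLp_of_cauchy_tendsto one_le_two (fun n => (u n).2.2.1) _ hmeas hconv
  obtain ⟨C, hC⟩ := hcauchy.isBounded_range.exists_norm_le
  let G : E.Space := ⟨g, mem_deBrangesSubmodule_of_tendsto hE
    (fun n => hC _ (Set.mem_range_self n)) hg hL hlim⟩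
  refine ⟨G, tendsto_iff_norm_sub_tendsto_zero.2
    (((ENNReal.tendsto_toReal ENNReal.zero_ne_top).comp hconv).congr fun n => ?_)⟩
  rw [Function.comp_apply, eLpNorm_div_sub_div (u n) G, ENNReal.toReal_ofReal (norm_nonneg _)]

theorem inner_kernel (hE : ∀ x : ℝ, E x ≠ 0) (f : E.Space) (w : ℂ) :
    inner ℂ (E.kernel w) f = f w := by
  have := completeSpace hE
  set k := (InnerProductSpace.toDual ℂ E.Space).symm (evalCLM hE w) with hk
  have hinner : ∀ g : E.Space, inner ℂ k g = g w := fun g => by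
    rw [hk, InnerProductSpace.toDual_symm_apply, evalCLM_apply]
  -- Off the real line the kernel already reproduces, so there `k z = ⟪K_z, k⟫ = conj (K_z w)`.
  have hkernel : k = E.kernel w := by
    refine ext fun z => congrFun (Continuous.ext_on dense_setOf_im_ne_zero k.2.1.continuous
      (E.differentiable_kernelFun w).continuous fun z hz => ?_) z
    rw [← inner_kernel_of_im_ne_zero hE k hz, ← inner_conj_symm, hinner, kernel_apply,
      conj_kernelFun]
  rw [← hkernel, hinner]

theorem norm_kernel_sq (hE : ∀ x : ℝ, E x ≠ 0) (w : ℂ) :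
    ((‖E.kernel w‖ ^ 2 : ℝ) : ℂ) = E.kernelFun w w := by
  rw [← kernel_apply, ← inner_kernel hE, inner_self_eq_norm_sq_to_K]
  push_cast
  rfl

theorem norm_apply_le (hE : ∀ x : ℝ, E x ≠ 0) (f : E.Space) (w : ℂ) :
    ‖f w‖ ≤ ‖E.kernel w‖ * ‖f‖ := by
  rw [← inner_kernel hE f w]
  exact norm_inner_le_norm _ _

end Space

end HermiteBiehler

/-! ### The decomposition of `H(EF)` -/

theorem exists_mul_ne_zero_upperHalf {f g : ℂ → ℂ} (hf : DifferentiableOn ℂ f upperHalf)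
    (hg : DifferentiableOn ℂ g upperHalf) (hf0 : ∃ z ∈ upperHalf, f z ≠ 0)
    (hg0 : ∃ z ∈ upperHalf, g z ≠ 0) : ∃ z ∈ upperHalf, f z * g z ≠ 0 := by
  obtain ⟨u, hu, hfu⟩ := hf0
  obtain ⟨v, hv, hgv⟩ := hg0
  by_contra! hzero
  have hg_near : g =ᶠ[𝓝 u] 0 := by
    have hnhds := isOpen_upperHalf.mem_nhds hu
    filter_upwards [(hf.differentiableAt hnhds).continuousAt.eventually_ne hfu, hnhds] with z hfz hz
    exact (mul_eq_zero.1 (hzero z hz)).resolve_left hfz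
  exact hgv ((hg.analyticOnNhd isOpen_upperHalf).eqOn_zero_of_preconnected_of_eventuallyEq_zero
    isPreconnected_upperHalf hu hg_near hv)

theorem meanType_nonpos_congr {f g : ℂ → ℂ} (hf : meanType f ≤ 0)
    (h : ∀ z ∈ upperHalf, g z = f z) : meanType g ≤ 0 := by
  rw [meanType_nonpos_iff] at hf ⊢
  intro ε hε
  filter_upwards [hf ε hε, eventually_gt_atTop 0] with y hfy hy
  rwa [h _ (show 0 < ((y : ℂ) * Complex.I).im by simpa)]

namespace IsBoundedType

variable {f g : ℂ → ℂ}

theorem of_norm_le (hf : DifferentiableOn ℂ f upperHalf) {C : ℝ}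
    (h : ∀ z ∈ upperHalf, ‖f z‖ ≤ C) : IsBoundedType f :=
  ⟨f, 1, hf, differentiableOn_const 1, ⟨C, h⟩, ⟨1, by simp⟩, ⟨Complex.I, I_mem_upperHalf, by simp⟩,
    by simp⟩

theorem mul (hf : IsBoundedType f) (hg : IsBoundedType g) : IsBoundedType fun z => f z * g z := by
  obtain ⟨P, Q, hP, hQ, ⟨a, ha⟩, ⟨b, hb⟩, hQ0, hPQ⟩ := hf
  obtain ⟨P', Q', hP', hQ', ⟨a', ha'⟩, ⟨b', hb'⟩, hQ0', hPQ'⟩ := hg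
  refine ⟨fun z => P z * P' z, fun z => Q z * Q' z, hP.mul hP', hQ.mul hQ',
    ⟨a * a', fun z hz => norm_mul_le_of_le (ha z hz) (ha' z hz)⟩,
    ⟨b * b', fun z hz => norm_mul_le_of_le (hb z hz) (hb' z hz)⟩,
    exists_mul_ne_zero_upperHalf hQ hQ' hQ0 hQ0', fun z hz => ?_⟩
  simp only [← hPQ z hz, ← hPQ' z hz]
  ring

theorem congr (hf : IsBoundedType f) (h : ∀ z ∈ upperHalf, g z = f z) : IsBoundedType g := by
  obtain ⟨P, Q, hP, hQ, hPb, hQb, hQ0, hPQ⟩ := hf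
  exact ⟨P, Q, hP, hQ, hPb, hQb, hQ0, fun z hz => by rw [h z hz, hPQ z hz]⟩

end IsBoundedType

theorem starFun_mul (f g : ℂ → ℂ) (z : ℂ) :
    starFun (fun z => f z * g z) z = starFun f z * starFun g z :=
  map_mul _ _ _

namespace HermiteBiehler

variable {E F : HermiteBiehler}

theorem norm_starFun_div_le_one (E : HermiteBiehler) {z : ℂ} (hz : z ∈ upperHalf) :
    ‖starFun E z / E z‖ ≤ 1 := by
  rw [norm_div, starFun, RCLike.norm_conj]
  exact div_le_one_of_le₀ (E.norm_conj_lt' z hz).le (norm_nonneg _)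

theorem isBoundedType_starFun_div (E : HermiteBiehler) :
    IsBoundedType fun z => starFun E z / E z :=
  .of_norm_le (E.differentiable.starFun.differentiableOn.div
    E.differentiable.differentiableOn fun _ hz => E.ne_zero hz) fun _ => E.norm_starFun_div_le_one

theorem meanType_starFun_div_nonpos (E : HermiteBiehler) :
    meanType (fun z => starFun E z / E z) ≤ 0 := by
  refine meanType_nonpos_of_bounded (C := 1) ?_
  filter_upwards [eventually_gt_atTop 0] with y hy
  exact E.norm_starFun_div_le_one (show 0 < ((y : ℂ) * Complex.I).im by simpa)

theorem norm_mul_starFun_div_mul {t : ℝ} (ht : E t ≠ 0) (f : ℂ → ℂ) :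
    ‖f t * starFun E t / (E * F) t‖ = ‖f t / F t‖ := by
  rw [mul_apply, mul_comm (E t), norm_div, norm_mul, norm_mul, starFun_ofReal, RCLike.norm_conj,
    mul_div_mul_right _ _ (norm_ne_zero_iff.2 ht), norm_div]

theorem mul_mem_deBrangesSubmodule (hF : ∀ x : ℝ, F x ≠ 0) (f : E.Space) :
    (fun z => f z * F z) ∈ (E * F).deBrangesSubmodule := by
  obtain ⟨hf, hL, hb, hm, hb', hm'⟩ := f.2
  have hdiv : ∀ z ∈ upperHalf, f z * F z / (E * F) z = f z / E z := fun z hz => by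
    rw [mul_apply, mul_div_mul_right _ _ (F.ne_zero hz)]
  have hstar : ∀ z ∈ upperHalf, starFun (fun z => f z * F z) z / (E * F) z =
      starFun f z / E z * (starFun F z / F z) := fun z _ => by
    rw [mul_apply, starFun_mul, mul_div_mul_comm]
  refine ⟨hf.mul F.differentiable, hL.ae_eq (.of_forall fun t => ?_), hb.congr hdiv,
    meanType_nonpos_congr hm hdiv, (hb'.mul F.isBoundedType_starFun_div).congr hstar,
    meanType_nonpos_congr (meanType_mul_nonpos hm' F.meanType_starFun_div_nonpos) hstar⟩
  simp only [mul_apply]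
  exact (mul_div_mul_right _ _ (hF t)).symm

theorem mul_starFun_mem_deBrangesSubmodule (hE : ∀ x : ℝ, E x ≠ 0) (g : F.Space) :
    (fun z => g z * starFun E z) ∈ (E * F).deBrangesSubmodule := by
  obtain ⟨hg, hL, hb, hm, hb', hm'⟩ := g.2
  have hdiv : ∀ z ∈ upperHalf, g z * starFun E z / (E * F) z =
      g z / F z * (starFun E z / E z) := fun z _ => by
    rw [mul_apply, mul_comm (E z), mul_div_mul_comm]
  have hstar : ∀ z ∈ upperHalf, starFun (fun z => g z * starFun E z) z / (E * F) z =
      starFun g z / F z := fun z hz => by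
    rw [mul_apply, starFun_mul, starFun_starFun, mul_comm (E z),
      mul_div_mul_right _ _ (E.ne_zero hz)]
  have hdiff : Differentiable ℂ fun z => g z * starFun E z := hg.mul E.differentiable.starFun
  exact ⟨hdiff, hL.congr_norm ((E * F).measurable_div hdiff.continuous).aestronglyMeasurable
      (.of_forall fun t => (norm_mul_starFun_div_mul (hE t) g).symm),
    (hb.mul E.isBoundedType_starFun_div).congr hdiv,
    meanType_nonpos_congr (meanType_mul_nonpos hm E.meanType_starFun_div_nonpos) hdiv,
    hb'.congr hstar, meanType_nonpos_congr hm' hstar⟩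

/-- The isometry `f ↦ f F` of `H(E)` into `H(EF)`. -/
noncomputable def mulRight (E F : HermiteBiehler) (hF : ∀ x : ℝ, F x ≠ 0) :
    E.Space →ₗᵢ[ℂ] (E * F).Space where
  toFun f := ⟨fun z => f z * F z, mul_mem_deBrangesSubmodule hF f⟩
  map_add' f g := Space.ext fun z => add_mul (f z) (g z) (F z)
  map_smul' c f := Space.ext fun z => mul_assoc c (f z) (F z)
  norm_map' f := by
    rw [← sq_eq_sq₀ (norm_nonneg _) (norm_nonneg _), Space.norm_sq_eq, Space.norm_sq_eq]
    congr 1 with t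
    exact congrArg (‖·‖ ^ 2) (mul_div_mul_right (f t) (E t) (hF t))

/-- The isometry `g ↦ g E*` of `H(F)` into `H(EF)`. -/
noncomputable def mulStar (E F : HermiteBiehler) (hE : ∀ x : ℝ, E x ≠ 0) :
    F.Space →ₗᵢ[ℂ] (E * F).Space where
  toFun g := ⟨fun z => g z * starFun E z, mul_starFun_mem_deBrangesSubmodule hE g⟩
  map_add' f g := Space.ext fun z => add_mul (f z) (g z) (starFun E z)
  map_smul' c f := Space.ext fun z => mul_assoc c (f z) (starFun E z)
  norm_map' g := by
    rw [← sq_eq_sq₀ (norm_nonneg _) (norm_nonneg _), Space.norm_sq_eq, Space.norm_sq_eq]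
    congr 1 with t
    exact congrArg (· ^ 2) (norm_mul_starFun_div_mul (hE t) g)

theorem mulRight_apply (hF : ∀ x : ℝ, F x ≠ 0) (f : E.Space) (z : ℂ) :
    E.mulRight F hF f z = f z * F z := rfl

theorem mulStar_apply (hE : ∀ x : ℝ, E x ≠ 0) (g : F.Space) (z : ℂ) :
    E.mulStar F hE g z = g z * starFun E z := rfl

theorem kernelFun_mul_eq (E F : HermiteBiehler) (w z : ℂ) :
    (E * F).kernelFun w z = conj (F w) * (E.kernelFun w z * F z) +
      E (conj w) * (F.kernelFun w z * starFun E z) := by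
  revert z
  refine congrFun (Continuous.ext_on (dense_compl_singleton (conj w))
    ((E * F).differentiable_kernelFun w).continuous ?_ fun z hz => ?_)
  · have hKE := (E.differentiable_kernelFun w).continuous
    have hKF := (F.differentiable_kernelFun w).continuous
    have hF := F.differentiable.continuous
    have hEstar := E.differentiable.starFun.continuous
    fun_prop
  · have hden : 2 * Real.pi * Complex.I * (conj w - z) ≠ 0 :=
      mul_ne_zero Complex.two_pi_I_ne_zero (sub_ne_zero.2 (Ne.symm hz))
    have hKE := E.kernelFun_mul w z
    have hKF := F.kernelFun_mul w z
    have hstar : starFun (E * F).toFun z = starFun E z * starFun F z := starFun_mul E F z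
    refine mul_right_cancel₀ hden ?_
    rw [(E * F).kernelFun_mul w z, add_mul]
    simp only [kernelNum] at hKE hKF ⊢
    rw [hstar, mul_apply, mul_apply, mul_apply, map_mul]
    linear_combination (-conj (F w) * F z) * hKE - (E (conj w) * starFun E z) * hKF

theorem kernel_mul_eq (hE : ∀ x : ℝ, E x ≠ 0) (hF : ∀ x : ℝ, F x ≠ 0) (w : ℂ) :
    (E * F).kernel w = conj (F w) • E.mulRight F hF (E.kernel w) +
      E (conj w) • E.mulStar F hE (F.kernel w) :=
  Space.ext fun z => kernelFun_mul_eq E F w z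

theorem mul_ne_zero_ofReal (hE : ∀ x : ℝ, E x ≠ 0) (hF : ∀ x : ℝ, F x ≠ 0) (x : ℝ) :
    (E * F) x ≠ 0 := mul_ne_zero (hE x) (hF x)

theorem Space.eq_zero_of_apply_ofReal_eq_zero {f : E.Space} (hf : ∀ t : ℝ, f t = 0) : f = 0 := by
  rw [← norm_eq_zero, ← sq_eq_zero_iff, Space.norm_sq_eq]
  simp only [hf, zero_div, norm_zero, ne_eq, OfNat.ofNat_ne_zero, not_false_eq_true, zero_pow,
    integral_zero]

theorem inner_mulRight_kernel_mulStar (hE : ∀ x : ℝ, E x ≠ 0) (hF : ∀ x : ℝ, F x ≠ 0) (t : ℝ)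
    (g : F.Space) : inner ℂ (E.mulRight F hF (E.kernel t)) (E.mulStar F hE g) = 0 := by
  have heval := Space.inner_kernel (mul_ne_zero_ofReal hE hF) (E.mulStar F hE g) t
  rw [kernel_mul_eq hE hF, inner_add_left, inner_smul_left, inner_smul_left,
    LinearIsometry.inner_map_map, Space.inner_kernel hF, mulStar_apply, Complex.conj_conj,
    Complex.conj_ofReal, starFun_ofReal, mul_comm (conj (E t)), add_eq_right] at heval
  exact (mul_eq_zero.1 heval).resolve_left (hF t)

theorem inner_mulRight_mulStar (hE : ∀ x : ℝ, E x ≠ 0) (hF : ∀ x : ℝ, F x ≠ 0) (f : E.Space)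
    (g : F.Space) : inner ℂ (E.mulRight F hF f) (E.mulStar F hE g) = 0 := by
  have : CompleteSpace E.Space := Space.completeSpace hE
  have : CompleteSpace (E * F).Space := Space.completeSpace (mul_ne_zero_ofReal hE hF)
  let A := ContinuousLinearMap.adjoint (E.mulRight F hF).toContinuousLinearMap
  have hA : A (E.mulStar F hE g) = 0 := Space.eq_zero_of_apply_ofReal_eq_zero fun t => by
    rw [← Space.inner_kernel hE, ContinuousLinearMap.adjoint_inner_right]
    exact inner_mulRight_kernel_mulStar hE hF t g
  rw [← LinearIsometry.coe_toContinuousLinearMap, ← ContinuousLinearMap.adjoint_inner_right]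
  exact hA ▸ inner_zero_right f

theorem orthogonal_range_mulRight (hE : ∀ x : ℝ, E x ≠ 0) (hF : ∀ x : ℝ, F x ≠ 0) :
    (LinearMap.range (E.mulRight F hF).toLinearMap)ᗮ =
      LinearMap.range (E.mulStar F hE).toLinearMap := by
  have : CompleteSpace F.Space := Space.completeSpace hF
  have : CompleteSpace (E * F).Space := Space.completeSpace (mul_ne_zero_ofReal hE hF)
  ext h
  rw [Submodule.mem_orthogonal]
  constructor
  · intro horth
    refine ⟨ContinuousLinearMap.adjoint (E.mulStar F hE).toContinuousLinearMap h,
      Space.ext fun w => ?_⟩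
    have hker : inner ℂ (E.mulRight F hF (E.kernel w)) h = 0 := horth _ ⟨_, rfl⟩
    change E.mulStar F hE _ w = _
    rw [mulStar_apply, ← Space.inner_kernel hF, ContinuousLinearMap.adjoint_inner_right,
      ← Space.inner_kernel (mul_ne_zero_ofReal hE hF) h w, kernel_mul_eq hE hF, inner_add_left,
      inner_smul_left, inner_smul_left, hker, mul_zero, zero_add, mul_comm]
    rfl
  · rintro ⟨g, rfl⟩ _ ⟨f, rfl⟩
    exact inner_mulRight_mulStar hE hF f g

end HermiteBiehler

/-! ### Orthonormal bases of reproducing kernels and dilation -/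

theorem norm_sq_sub_sq_of_norm_eq {R : ℝ} {z : ℂ} (hz : ‖z‖ = R) :
    ‖(R : ℂ) ^ 2 - z ^ 2‖ = 2 * R * |z.im| := by
  have hfactor : (R : ℂ) ^ 2 - z ^ 2 = z * (conj z - z) := by
    rw [mul_sub, Complex.mul_conj', hz, sq z]
  have him : ‖conj z - z‖ = 2 * |z.im| := by
    rw [norm_sub_rev, Complex.sub_conj, norm_mul, Complex.norm_I, mul_one, Complex.norm_real,
      norm_mul, Real.norm_two, Real.norm_eq_abs]
  rw [hfactor, norm_mul, hz, him]
  ring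

/-- The factor `R² - z²`, of modulus `2R |Im z|` on the circle of radius `R`, absorbs the
singularity of the bound at the two real points of that circle. -/
theorem norm_mul_sq_sub_sq_le {q : ℂ → ℂ} (hq : Differentiable ℂ q) {C : ℝ} (hC : 0 ≤ C)
    (h : ∀ z : ℂ, z.im ≠ 0 → ‖q z‖ ≤ C * ((1 + ‖z‖) / |z.im|)) {R : ℝ} (hR : 0 < R) {z : ℂ}
    (hz : ‖z‖ ≤ R) : ‖q z * ((R : ℂ) ^ 2 - z ^ 2)‖ ≤ 2 * R * (C * (1 + R)) := by
  have hdiff : Differentiable ℂ fun z => q z * ((R : ℂ) ^ 2 - z ^ 2) := by fun_prop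
  refine Complex.norm_le_of_forall_mem_frontier_norm_le (U := Metric.ball 0 R)
    (f := fun z => q z * ((R : ℂ) ^ 2 - z ^ 2)) Metric.isBounded_ball hdiff.diffContOnCl
    (fun x hx => ?_) (by rwa [closure_ball _ hR.ne', mem_closedBall_zero_iff])
  rw [frontier_ball _ hR.ne', mem_sphere_zero_iff_norm] at hx
  rw [norm_mul, norm_sq_sub_sq_of_norm_eq hx]
  by_cases him : x.im = 0
  · rw [him, abs_zero, mul_zero, mul_zero]
    positivity
  · calc ‖q x‖ * (2 * R * |x.im|) ≤ C * ((1 + ‖x‖) / |x.im|) * (2 * R * |x.im|) := by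
          gcongr
          exact h x him
      _ = 2 * R * (C * (1 + R)) := by
          rw [hx]
          field_simp [abs_ne_zero.2 him]

theorem exists_const_of_norm_le_div_im {q : ℂ → ℂ} (hq : Differentiable ℂ q) {C : ℝ} (hC : 0 ≤ C)
    (h : ∀ z : ℂ, z.im ≠ 0 → ‖q z‖ ≤ C * ((1 + ‖z‖) / |z.im|)) : ∃ c, ∀ z, q z = c := by
  refine hq.exists_const_forall_eq_of_bounded (isBounded_iff_forall_norm_le.2 ⟨4 * C, ?_⟩)
  rintro _ ⟨z, rfl⟩
  obtain ⟨R, hR⟩ : ∃ R, R = 2 * (1 + ‖z‖) := ⟨_, rfl⟩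
  have hzR : ‖z‖ = R / 2 - 1 := by linarith
  have hR2 : 2 ≤ R := by linarith [norm_nonneg z]
  have hle := norm_mul_sq_sub_sq_le hq hC h (by linarith : 0 < R) (by linarith : ‖z‖ ≤ R)
  have hfactor : 3 / 4 * R ^ 2 ≤ ‖(R : ℂ) ^ 2 - z ^ 2‖ := by
    have hsub := norm_sub_norm_le ((R : ℂ) ^ 2) (z ^ 2)
    rw [norm_pow, norm_pow, Complex.norm_real, Real.norm_eq_abs, sq_abs, hzR] at hsub
    nlinarith
  refine le_of_mul_le_mul_right ?_ (by positivity : 0 < 3 / 4 * R ^ 2)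
  calc ‖q z‖ * (3 / 4 * R ^ 2) ≤ ‖q z * ((R : ℂ) ^ 2 - z ^ 2)‖ := by rw [norm_mul]; gcongr
    _ ≤ 2 * R * (C * (1 + R)) := hle
    _ ≤ 4 * C * (3 / 4 * R ^ 2) := by nlinarith [mul_nonneg hC (by linarith : 0 ≤ R)]

theorem exists_differentiable_eq_mul {f h : ℂ → ℂ} (hf : Differentiable ℂ f)
    (hh : Differentiable ℂ h) (hz : ∀ z, h z = 0 → f z = 0 ∧ deriv h z ≠ 0) :
    ∃ q, Differentiable ℂ q ∧ ∀ z, f z = q z * h z := by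
  classical
  refine ⟨fun z => if h z = 0 then deriv f z / deriv h z else f z / h z, fun a => ?_, fun z => ?_⟩
  · by_cases ha : h a = 0
    · obtain ⟨hfa, hda⟩ := hz a ha
      have hdslope {g : ℂ → ℂ} (hg : Differentiable ℂ g) : Differentiable ℂ (dslope g a) := by
        rw [← differentiableOn_univ, Complex.differentiableOn_dslope univ_mem]
        exact hg.differentiableOn
      have hne : dslope h a a ≠ 0 := by rwa [dslope_same]
      refine ((hdslope hf a).div (hdslope hh a) hne).congr_of_eventuallyEq ?_
      filter_upwards [(hdslope hh a).continuousAt.eventually_ne hne] with z hza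
      rw [Pi.div_apply]
      rcases eq_or_ne z a with rfl | hne'
      · rw [if_pos ha, dslope_same, dslope_same]
      · rw [dslope_of_ne _ hne', slope_def_field, ha, sub_zero] at hza
        rw [dslope_of_ne _ hne', dslope_of_ne _ hne', slope_def_field, slope_def_field, hfa, ha,
          sub_zero, sub_zero, div_div_div_cancel_right₀ (sub_ne_zero.2 hne'),
          if_neg (div_ne_zero_iff.1 hza).1]
    · refine ((hf a).div (hh a) ha).congr_of_eventuallyEq ?_
      filter_upwards [(hh a).continuousAt.eventually_ne ha] with z hhz
      rw [if_neg hhz, Pi.div_apply]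
  · dsimp only
    split_ifs with hhz
    · rw [hhz, mul_zero, (hz z hhz).1]
    · rw [div_mul_cancel₀ _ hhz]

theorem re_add_div_sub (a b : ℂ) : ((a + b) / (a - b)).re = (‖a‖ ^ 2 - ‖b‖ ^ 2) / ‖a - b‖ ^ 2 := by
  rw [Complex.div_re, ← Complex.normSq_eq_norm_sq, ← Complex.normSq_eq_norm_sq,
    ← Complex.normSq_eq_norm_sq, ← add_div, Complex.normSq_apply a, Complex.normSq_apply b]
  congr 1
  simp only [Complex.add_re, Complex.sub_re, Complex.add_im, Complex.sub_im]
  ring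

theorem norm_exp_I_mul (α : ℝ) : ‖Complex.exp (Complex.I * α)‖ = 1 := by
  rw [mul_comm, Complex.norm_exp_ofReal_mul_I]

theorem norm_exp_neg_I_mul (α : ℝ) : ‖Complex.exp (-Complex.I * α)‖ = 1 := by
  rw [neg_mul, ← mul_neg, ← Complex.ofReal_neg, norm_exp_I_mul]

theorem injective_of_apply_eq_int_mul_pi_add {φ : ℝ → ℝ} {lam : ℤ → ℝ} {α : ℝ}
    (hlam : ∀ n : ℤ, φ (lam n) = n * Real.pi + α) : Function.Injective lam := fun m n hmn => by
  have heq := congrArg φ hmn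
  rw [hlam, hlam, add_left_inj] at heq
  exact_mod_cast mul_right_cancel₀ Real.pi_ne_zero heq

namespace HermiteBiehler

variable {G : HermiteBiehler} {α : ℝ}

theorem differentiable_angleFun (G : HermiteBiehler) (α : ℝ) : Differentiable ℂ (G.angleFun α) :=
  (G.differentiable.const_mul _).sub (G.differentiable.starFun.const_mul _)

theorem conj_angleFun_conj (G : HermiteBiehler) (α : ℝ) (z : ℂ) :
    conj (G.angleFun α (conj z)) = -G.angleFun α z := by
  simp only [angleFun, starFun, map_sub, map_mul, Complex.conj_conj, ← Complex.exp_conj, map_neg,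
    Complex.conj_I, Complex.conj_ofReal, neg_neg]
  ring

theorem IsPhase.angleFun_ofReal {φ : ℝ → ℝ} (hφ : G.IsPhase φ) (x : ℝ) :
    G.angleFun α x = ‖G x‖ * (Complex.exp (Complex.I * (α - φ x)) -
      Complex.exp (-(Complex.I * (α - φ x)))) := by
  have hconj : conj (Complex.exp (-Complex.I * φ x)) = Complex.exp (Complex.I * φ x) := by
    rw [← Complex.exp_conj, map_mul, map_neg, Complex.conj_I, Complex.conj_ofReal, neg_neg]
  have hsub : Complex.I * ((α : ℂ) - φ x) = Complex.I * α + -Complex.I * φ x := by ring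
  have hneg : -(Complex.I * (α : ℂ) + -Complex.I * φ x) = -Complex.I * α + Complex.I * φ x := by
    ring
  rw [angleFun, starFun_ofReal, hφ.2.2 x]
  simp only [norm_mul, norm_exp_neg_I_mul, Complex.norm_real, norm_norm, mul_one, map_mul,
    Complex.conj_ofReal, hconj]
  rw [hsub, Complex.exp_add, hneg, Complex.exp_add]
  ring

theorem IsPhase.angleFun_ofReal_eq_zero_iff (hG : ∀ x : ℝ, G x ≠ 0) {φ : ℝ → ℝ}
    (hφ : G.IsPhase φ) (x : ℝ) : G.angleFun α x = 0 ↔ ∃ n : ℤ, φ x = n * Real.pi + α := by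
  have hnorm : (‖G x‖ : ℂ) ≠ 0 := by exact_mod_cast norm_ne_zero_iff.2 (hG x)
  rw [hφ.angleFun_ofReal, mul_eq_zero, or_iff_right hnorm, sub_eq_zero,
    Complex.exp_eq_exp_iff_exists_int]
  constructor
  · rintro ⟨n, hn⟩
    have hcast : (α - φ x : ℂ) = n * Real.pi := by
      refine mul_left_cancel₀ (mul_ne_zero two_ne_zero Complex.I_ne_zero) ?_
      linear_combination hn
    have hreal : α - φ x = n * Real.pi := by exact_mod_cast hcast
    exact ⟨-n, by push_cast; linarith⟩
  · rintro ⟨n, hn⟩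
    refine ⟨-n, ?_⟩
    rw [hn]
    push_cast
    ring

theorem IsPhase.range_eq_setOf_angleFun_eq_zero (hG : ∀ x : ℝ, G x ≠ 0) {φ : ℝ → ℝ}
    (hφ : G.IsPhase φ) {lam : ℤ → ℝ} (hlam : ∀ n : ℤ, φ (lam n) = n * Real.pi + α) :
    Set.range lam = {x : ℝ | G.angleFun α x = 0} := by
  ext x
  rw [Set.mem_ofPred_eq, hφ.angleFun_ofReal_eq_zero_iff hG]
  refine exists_congr fun n => ?_
  rw [← hlam n, hφ.2.1.injective.eq_iff, eq_comm]

theorem angleFun_ne_zero {z : ℂ} (hz : z.im ≠ 0) : G.angleFun α z ≠ 0 := by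
  intro hzero
  have hnorm := congrArg norm (sub_eq_zero.1 hzero)
  rw [norm_mul, norm_mul, norm_exp_I_mul, norm_exp_neg_I_mul, one_mul, one_mul, starFun,
    RCLike.norm_conj] at hnorm
  rcases hz.lt_or_gt with hneg | hpos
  · have hlt := G.norm_conj_lt' (conj z) (show 0 < (conj z).im by simpa)
    rw [Complex.conj_conj] at hlt
    exact hlt.ne hnorm
  · exact (G.norm_conj_lt' z hpos).ne' hnorm

theorem kernelNum_eq_mul_angleFun {x : ℝ} (hx : G.angleFun α x = 0) (z : ℂ) :
    G.kernelNum x z = conj (G x) * Complex.exp (-Complex.I * α) * G.angleFun α z := by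
  have hexp : Complex.exp (-Complex.I * α) * Complex.exp (Complex.I * α) = 1 := by
    rw [← Complex.exp_add, neg_mul, neg_add_cancel, Complex.exp_zero]
  have hboundary := sub_eq_zero.1 hx
  rw [starFun_ofReal] at hboundary
  rw [kernelNum, angleFun, Complex.conj_ofReal]
  linear_combination (-conj (G x) * G z + G x * starFun G z) * hexp -
    (Complex.exp (-Complex.I * α) * starFun G z) * hboundary

theorem kernel_ne_zero (hG : ∀ x : ℝ, G x ≠ 0) {x : ℝ} (hx : G.angleFun α x = 0) :
    G.kernel x ≠ 0 := by
  intro hker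
  have hnum := G.kernelFun_mul x Complex.I
  rw [← Space.kernel_apply, hker, Space.zero_apply, zero_mul, kernelNum_eq_mul_angleFun hx] at hnum
  have hconj : conj (G x) ≠ 0 := (map_ne_zero _).2 (hG x)
  have hI : G.angleFun α Complex.I ≠ 0 := angleFun_ne_zero (by simp)
  exact mul_ne_zero (mul_ne_zero hconj (Complex.exp_ne_zero _)) hI hnum.symm

theorem deriv_angleFun_ne_zero (hG : ∀ x : ℝ, G x ≠ 0) {x : ℝ} (hx : G.angleFun α x = 0) :
    deriv (G.angleFun α) x ≠ 0 := by
  intro hderiv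
  refine kernel_ne_zero hG hx ?_
  have hnorm := Space.norm_kernel_sq hG x
  have hnum : G.kernelNum x = fun z =>
      conj (G x) * Complex.exp (-Complex.I * α) * G.angleFun α z :=
    funext (kernelNum_eq_mul_angleFun hx)
  rw [kernelFun, if_pos (Complex.conj_ofReal x).symm, hnum, Complex.conj_ofReal,
    deriv_const_mul _ (G.differentiable_angleFun α x), hderiv] at hnorm
  simpa using hnorm

theorem inner_kernel_kernel_eq_zero (hG : ∀ x : ℝ, G x ≠ 0) {x y : ℝ} (hx : G.angleFun α x = 0)
    (hy : G.angleFun α y = 0) (hxy : x ≠ y) : inner ℂ (G.kernel x) (G.kernel y) = 0 := by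
  rw [Space.inner_kernel hG, Space.kernel_apply]
  have hnum := G.kernelFun_mul y x
  rw [kernelNum_eq_mul_angleFun hy, hx, mul_zero, Complex.conj_ofReal] at hnum
  have hsub : (y : ℂ) - x ≠ 0 := sub_ne_zero.2 (Complex.ofReal_injective.ne hxy.symm)
  exact (mul_eq_zero.1 hnum).resolve_right (mul_ne_zero Complex.two_pi_I_ne_zero hsub)

theorem norm_kernel_sq_mul (hG : ∀ x : ℝ, G x ≠ 0) (z : ℂ) :
    ‖G.kernel z‖ ^ 2 * (4 * Real.pi * z.im) = ‖G z‖ ^ 2 - ‖G (conj z)‖ ^ 2 := by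
  have hnum := G.kernelFun_mul z z
  rw [← Space.norm_kernel_sq hG, kernelNum, starFun, mul_comm (conj (G z)), Complex.mul_conj',
    Complex.mul_conj', show conj z - z = -(2 * z.im : ℝ) * Complex.I by
      linear_combination -Complex.sub_conj z] at hnum
  refine Complex.ofReal_injective ?_
  push_cast at hnum ⊢
  rw [← hnum]
  linear_combination (4 * ‖G.kernel z‖ ^ 2 * Real.pi * z.im : ℂ) * Complex.I_sq

theorem re_add_div_angleFun (hG : ∀ x : ℝ, G x ≠ 0) (z : ℂ) :
    ((Complex.exp (Complex.I * α) * G z + Complex.exp (-Complex.I * α) * starFun G z) /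
      G.angleFun α z).re = ‖G.kernel z‖ ^ 2 * (4 * Real.pi * z.im) / ‖G.angleFun α z‖ ^ 2 := by
  rw [norm_kernel_sq_mul hG, angleFun, re_add_div_sub, norm_mul, norm_mul, norm_exp_I_mul,
    norm_exp_neg_I_mul, one_mul, one_mul, starFun, RCLike.norm_conj]

theorem exists_norm_kernel_le_mul_angleFun (hG : ∀ x : ℝ, G x ≠ 0) (α : ℝ) :
    ∃ C : ℝ, 0 ≤ C ∧ ∀ z ∈ upperHalf,
      ‖G.kernel z‖ ≤ C * ((1 + ‖z‖) / z.im * ‖G.angleFun α z‖) := by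
  obtain ⟨C, hC⟩ := exists_norm_le_of_re_nonneg
    (((G.differentiable.const_mul (Complex.exp (Complex.I * α))).add
      (G.differentiable.starFun.const_mul (Complex.exp (-Complex.I * α)))).differentiableOn.div
      (G.differentiable_angleFun α).differentiableOn fun z hz => angleFun_ne_zero (ne_of_gt hz))
    fun z hz => by
      have him : 0 < z.im := hz
      refine (re_add_div_angleFun hG z).ge.trans' ?_
      positivity
  refine ⟨√(C / (4 * Real.pi)), Real.sqrt_nonneg _, fun z hz => ?_⟩
  have him : 0 < z.im := hz
  have hangle : 0 < ‖G.angleFun α z‖ := norm_pos_iff.2 (angleFun_ne_zero him.ne')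
  have hre := (re_add_div_angleFun hG z).ge.trans ((Complex.re_le_norm _).trans (hC z hz))
  rw [div_le_iff₀ (by positivity)] at hre
  have hsq : ‖G.kernel z‖ ^ 2 ≤
      C / (4 * Real.pi) * ((1 + ‖z‖) / z.im * ‖G.angleFun α z‖) ^ 2 := by
    refine (le_div_iff₀ (by positivity)).2 hre |>.trans_eq ?_
    field_simp
  refine (Real.le_sqrt_of_sq_le hsq).trans_eq ?_
  rw [Real.sqrt_mul' _ (sq_nonneg _), Real.sqrt_sq (by positivity)]

theorem Space.exists_norm_le_mul_angleFun (hG : ∀ x : ℝ, G x ≠ 0) (α : ℝ) :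
    ∃ C : ℝ, 0 ≤ C ∧ ∀ f : G.Space, ∀ z : ℂ, z.im ≠ 0 →
      ‖f z‖ ≤ C * ‖f‖ * ((1 + ‖z‖) / |z.im|) * ‖G.angleFun α z‖ := by
  obtain ⟨C, hC, hker⟩ := exists_norm_kernel_le_mul_angleFun hG α
  have hupper : ∀ f : G.Space, ∀ z ∈ upperHalf,
      ‖f z‖ ≤ C * ‖f‖ * ((1 + ‖z‖) / z.im) * ‖G.angleFun α z‖ := fun f z hz =>
    calc ‖f z‖ ≤ ‖G.kernel z‖ * ‖f‖ := Space.norm_apply_le hG f z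
      _ ≤ C * ((1 + ‖z‖) / z.im * ‖G.angleFun α z‖) * ‖f‖ := by gcongr; exact hker z hz
      _ = C * ‖f‖ * ((1 + ‖z‖) / z.im) * ‖G.angleFun α z‖ := by ring
  refine ⟨C, hC, fun f z hz => ?_⟩
  rcases hz.lt_or_gt with hneg | hpos
  · have hconj := hupper f.conjStar (conj z) (show 0 < (conj z).im by simpa)
    rwa [Space.conjStar_apply, Complex.conj_conj, RCLike.norm_conj, RCLike.norm_conj,
      Space.norm_conjStar, Complex.conj_im, ← abs_of_neg hneg,
      ← RCLike.norm_conj (G.angleFun α (conj z)), conj_angleFun_conj, norm_neg] at hconj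
  · rw [abs_of_pos hpos]
    exact hupper f z hpos

theorem Space.exists_eq_const_mul_angleFun (hG : ∀ x : ℝ, G x ≠ 0) (f : G.Space)
    (hf : ∀ x : ℝ, G.angleFun α x = 0 → f x = 0) : ∃ c : ℂ, ∀ z, f z = c * G.angleFun α z := by
  obtain ⟨q, hq, hfq⟩ := exists_differentiable_eq_mul f.2.1
    (G.differentiable_angleFun α) fun z hz => by
      have him : z.im = 0 := of_not_not fun him => angleFun_ne_zero him hz
      obtain ⟨x, rfl⟩ : ∃ x : ℝ, z = x := ⟨z.re, Complex.ext rfl him⟩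
      exact ⟨hf x hz, deriv_angleFun_ne_zero hG hz⟩
  obtain ⟨C, hC, hle⟩ := Space.exists_norm_le_mul_angleFun hG α
  obtain ⟨c, hc⟩ := exists_const_of_norm_le_div_im hq (C := C * ‖f‖) (by positivity) fun z hz => by
    refine le_of_mul_le_mul_right ?_ (norm_pos_iff.2 (angleFun_ne_zero (α := α) (G := G) hz))
    rw [← norm_mul, ← hfq]
    exact hle f z hz
  exact ⟨c, fun z => by rw [hfq, hc]⟩

theorem mem_angleSpace_iff (G : HermiteBiehler) (α : ℝ) (f : G.Space) : f ∈ G.angleSpace α ↔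
    ∀ h : G.Space, (∀ z, h z = G.angleFun α z) → inner ℂ h f = 0 := by
  unfold angleSpace
  split_ifs with hmem
  · refine Submodule.mem_orthogonal_singleton_iff_inner_right.trans
      ⟨fun hinner h hh => ?_, fun hall => hall _ fun z => rfl⟩
    rwa [show h = ⟨_, hmem⟩ from Space.ext hh]
  · refine ⟨fun _ h hh => (hmem ?_).elim, fun _ => Submodule.mem_top⟩
    rw [← funext hh]
    exact h.2

theorem isClosed_angleSpace (G : HermiteBiehler) (α : ℝ) :
    IsClosed (G.angleSpace α : Set G.Space) := by
  unfold angleSpace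
  split_ifs
  · exact Submodule.isClosed_orthogonal _
  · exact isClosed_univ

theorem eq_zero_of_mem_angleSpace (hG : ∀ x : ℝ, G x ≠ 0) {f : G.Space} (hf : f ∈ G.angleSpace α)
    (hzero : ∀ x : ℝ, G.angleFun α x = 0 → f x = 0) : f = 0 := by
  obtain ⟨c, hc⟩ := Space.exists_eq_const_mul_angleFun hG f hzero
  rcases eq_or_ne c 0 with rfl | hc0
  · exact Space.ext fun z => by rw [hc, zero_mul, Space.zero_apply]
  · have horth := (mem_angleSpace_iff G α f).1 hf (c⁻¹ • f) fun z => by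
      rw [Space.smul_apply, hc, inv_mul_cancel_left₀ hc0]
    rw [inner_smul_left] at horth
    exact inner_self_eq_zero.1
      ((mul_eq_zero.1 horth).resolve_left ((map_ne_zero _).2 (inv_ne_zero hc0)))

theorem kernel_mem_angleSpace (hG : ∀ x : ℝ, G x ≠ 0) {x : ℝ} (hx : G.angleFun α x = 0) :
    G.kernel x ∈ G.angleSpace α := by
  rw [mem_angleSpace_iff]
  intro h hh
  rw [← inner_conj_symm, Space.inner_kernel hG, hh, hx, map_zero]

theorem orthonormal_inv_norm_smul_kernel (hG : ∀ x : ℝ, G x ≠ 0) {ι : Type*} {x : ι → ℝ}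
    (hinj : Function.Injective x) (hx : ∀ i, G.angleFun α (x i) = 0) :
    Orthonormal ℂ fun i => (‖G.kernel (x i)‖⁻¹ : ℂ) • G.kernel (x i) :=
  ⟨fun i => norm_smul_inv_norm (kernel_ne_zero hG (hx i)), fun i j hij => by
    simp only [inner_smul_left, inner_smul_right,
      inner_kernel_kernel_eq_zero hG (hx i) (hx j) (hinj.ne hij), mul_zero]⟩

theorem sqrt_re_kernelFun (hG : ∀ x : ℝ, G x ≠ 0) (z : ℂ) :
    √(G.kernelFun z z).re = ‖G.kernel z‖ := by
  rw [← Space.norm_kernel_sq hG, Complex.ofReal_re, Real.sqrt_sq (norm_nonneg _)]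

theorem exists_hilbertBasis_angleSpace (hG : ∀ x : ℝ, G x ≠ 0) {ι : Type*} {x : ι → ℝ}
    (hinj : Function.Injective x) (hrange : Set.range x = {t : ℝ | G.angleFun α t = 0}) :
    ∃ b : HilbertBasis ι ℂ (G.angleSpace α), ∀ i, (b i : G.Space) =
      (√(G.kernelFun (x i) (x i)).re : ℂ)⁻¹ • G.kernel (x i) := by
  have : CompleteSpace G.Space := Space.completeSpace hG
  have : CompleteSpace (G.angleSpace α) := (G.isClosed_angleSpace α).completeSpace_coe
  have hx : ∀ i, G.angleFun α (x i) = 0 := fun i => hrange.subset ⟨i, rfl⟩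
  let v : ι → G.angleSpace α := fun i =>
    (‖G.kernel (x i)‖⁻¹ : ℂ) • ⟨G.kernel (x i), kernel_mem_angleSpace hG (hx i)⟩
  have hv : Orthonormal ℂ v :=
    (G.angleSpace α).subtypeₗᵢ.orthonormal_comp_iff.1
      (orthonormal_inv_norm_smul_kernel hG hinj hx)
  have hbot : (Submodule.span ℂ (Set.range v))ᗮ = ⊥ := by
    refine (Submodule.eq_bot_iff _).2 fun f hf => Subtype.ext (eq_zero_of_mem_angleSpace hG f.2 ?_)
    intro t ht
    obtain ⟨i, rfl⟩ := hrange.superset ht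
    have horth : inner ℂ ((‖G.kernel (x i)‖⁻¹ : ℂ) • G.kernel (x i)) (f : G.Space) = 0 :=
      (Submodule.mem_orthogonal _ _).1 hf (v i) (Submodule.subset_span ⟨i, rfl⟩)
    rw [inner_smul_left, Space.inner_kernel hG] at horth
    refine (mul_eq_zero.1 horth).resolve_left ((map_ne_zero _).2 (inv_ne_zero ?_))
    exact_mod_cast norm_ne_zero_iff.2 (kernel_ne_zero hG (hx i))
  refine ⟨HilbertBasis.mkOfOrthogonalEqBot hv hbot, fun i => ?_⟩
  rw [HilbertBasis.coe_mkOfOrthogonalEqBot, sqrt_re_kernelFun hG]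
  rfl

end HermiteBiehler

namespace IsParsevalFrame

variable {ι H K : Type*} [NormedAddCommGroup H] [InnerProductSpace ℂ H] [NormedAddCommGroup K]
  [InnerProductSpace ℂ K] {x : ι → H}

theorem hasSum_norm_inner (hx : IsParsevalFrame x) (f : H) :
    HasSum (fun n => ‖inner ℂ (x n) f‖ ^ 2) (‖f‖ ^ 2) := by
  simpa only [norm_inner_symm] using hx f

theorem memℓp_inner (hx : IsParsevalFrame x) (f : H) : Memℓp (fun n => inner ℂ (x n) f) 2 :=
  memℓp_gen (by simpa using (hx.hasSum_norm_inner f).summable)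

/-- The analysis operator `f ↦ (⟪xₙ, f⟫)ₙ` of a Parseval frame, which is an isometry into `ℓ²`. -/
noncomputable def analysis (hx : IsParsevalFrame x) : H →ₗᵢ[ℂ] lp (fun _ : ι => ℂ) 2 where
  toFun f := ⟨fun n => inner ℂ (x n) f, hx.memℓp_inner f⟩
  map_add' f g := lp.ext (funext fun n => inner_add_right (x n) f g)
  map_smul' c f := lp.ext (funext fun n => inner_smul_right (x n) f c)
  norm_map' f := by
    rw [← sq_eq_sq₀ (norm_nonneg _) (norm_nonneg _), ← (hx.hasSum_norm_inner f).tsum_eq]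
    exact_mod_cast lp.norm_rpow_eq_tsum (p := 2) (by norm_num)
      (⟨_, hx.memℓp_inner f⟩ : lp (fun _ : ι => ℂ) 2)

theorem exists_embedsInto (hx : IsParsevalFrame x) (b : HilbertBasis ι ℂ K) :
    ∃ T : H →ₗᵢ[ℂ] K, EmbedsInto T x b := by
  refine ⟨b.repr.symm.toLinearIsometry.comp hx.analysis, fun n => ?_⟩
  rw [Submodule.mem_orthogonal']
  rintro _ ⟨f, rfl⟩
  have hcoeff : inner ℂ (b n) (b.repr.symm (hx.analysis f)) = inner ℂ (x n) f := by
    rw [← b.repr_apply_apply, LinearIsometryEquiv.apply_symm_apply]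
    rfl
  change inner ℂ _ (b.repr.symm.toLinearIsometry.comp hx.analysis f) = 0
  rw [inner_sub_left, LinearIsometry.inner_map_map, sub_eq_zero]
  exact hcoeff

end IsParsevalFrame

end

theorem mainTheorem8 (E F : HermiteBiehler) (hE : ∀ x : ℝ, E x ≠ 0) (hF : ∀ x : ℝ, F x ≠ 0)
    (φ : ℝ → ℝ) (hφ : (E * F).IsPhase φ) (α : ℝ) (hα : α ∈ Set.Ico 0 Real.pi)
    (lam : ℤ → ℝ) (hlam : ∀ n : ℤ, φ (lam n) = n * Real.pi + α)
    (hframe : IsParsevalFrame (fun n : ℤ => E.kernel (lam n))) :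
    ∃ (I : E.Space →ₗᵢ[ℂ] (E * F).Space) (J : F.Space →ₗᵢ[ℂ] (E * F).Space),
      (∀ f z, I f z = f z * F z) ∧ (∀ g z, J g z = g z * starFun E z) ∧
      (LinearMap.range I.toLinearMap)ᗮ = LinearMap.range J.toLinearMap ∧
      ((E * F).angleFun α ∉ (E * F).deBrangesSubmodule → ∀ f, I f ∈ (E * F).angleSpace α) ∧
      ∃ b : HilbertBasis ℤ ℂ ((E * F).angleSpace α),
        (∀ n : ℤ, (b n : (E * F).Space) =
          (conj (F (lam n)) / (√((E * F).kernelFun (lam n) (lam n)).re : ℂ)) •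
              I (E.kernel (lam n)) +
            (E (lam n) / (√((E * F).kernelFun (lam n) (lam n)).re : ℂ)) •
              J (F.kernel (lam n))) ∧
        ∃ T : E.Space →ₗᵢ[ℂ] (E * F).angleSpace α,
          EmbedsInto T (fun n : ℤ => E.kernel (lam n)) (fun n : ℤ => b n) := by
  have hEF := HermiteBiehler.mul_ne_zero_ofReal hE hF
  obtain ⟨b, hb⟩ := HermiteBiehler.exists_hilbertBasis_angleSpace hEF
    (injective_of_apply_eq_int_mul_pi_add hlam) (hφ.range_eq_setOf_angleFun_eq_zero hEF hlam)
  refine ⟨E.mulRight F hF, E.mulStar F hE, HermiteBiehler.mulRight_apply hF,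
    HermiteBiehler.mulStar_apply hE, HermiteBiehler.orthogonal_range_mulRight hE hF,
    fun hangle f => ?_, b, fun n => ?_, hframe.exists_embedsInto b⟩
  · rw [HermiteBiehler.angleSpace, dif_neg hangle]
    exact Submodule.mem_top
  · rw [hb, HermiteBiehler.kernel_mul_eq hE hF, smul_add, smul_smul, smul_smul,
      Complex.conj_ofReal, inv_mul_eq_div, inv_mul_eq_div]
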